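/- **Theorem (Uniform strong consistency).** Let $\mathcal S=\{x\in[0,1]^d:\|x\|_1\le 1\}$, where $\|x\|_1=\sum_{i=1}^d|x_i|$, and write $\|G\|_\infty=\sup_{x\in\mathcal S}|G(x)|$. Let $X_1,X_2,\dots$ be i.i.d. random vectors in $\mathbb R^d$ with joint c.d.f. $F$, let $F_n(x)=\frac1n\sum_{i=1}^n \mathbf 1_{(-\infty,x]}(X_i)$ be the empirical c.d.f., and let $$F^\star_{n,m}(x)=\sum_{k\in\mathbb N_0^d,\ \|k\|_1\le m}F_n(k/m)\,P_{k,m}(x),\qquad P_{k,m}(x)=\frac{m!}{(m-\|k\|_1)!\prod_{i=1}^d k_i!}\,(1-\|x\|_1)^{m-\|k\|_1}\prod_{i=1}^d x_i^{k_i},\qquad x\in\mathcal S,$$ be the Bernstein estimator of $F$ of order $m$. Put $\alpha_n=(n^{-1}\log n)^{1/2}$ and $\beta_{n,m}=\alpha_n\sqrt{\alpha_m}$. 1. If $F$ is continuous on $\mathcal S$, then almost surely $\|F^\star_{n,m}-F\|_\infty\to0$ as $n\to\infty$ and $m\to\infty$ (so, in particular, along every sequence $m=m(n)\to\infty$). 2.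 Assume further that $F$ is differentiable on $\mathcal S$ and that its partial derivatives are Lipschitz continuous on $\mathcal S$. Then there is a constant $C>0$ depending only on $F$ and $d$ such that, almost surely, for all sufficiently large $n$ and all $m\ge2$ with $m^{-1}\le\beta_{n,m}\le\alpha_m$, $$\|F^\star_{n,m}-F_n\|_\infty\le C\,\beta_{n,m}.$$ In particular, for $m=n$, almost surely $\|F^\star_{n,n}-F_n\|_\infty\le C\,n^{-3/4}(\log n)^{3/4}$ for all sufficiently large $n$. 3. The conditions in 2 hold for example when $2n^{2/3}/\log n\le m\le n^2/\log n$: for all integers $n\ge2$ and $m$ in this range one has $m\ge2$ and $m^{-1}\le\beta_{n,m}\le\alpha_m$. -/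

import Mathlib

open MeasureTheory ProbabilityTheory Filter Topology

universe u

/-- The unit simplex `{x ∈ [0,1]^d : ‖x‖₁ ≤ 1}`. -/
def unitSimplex (d : ℕ) : Set (Fin d → ℝ) :=
  {x | (∀ i, x i ∈ Set.Icc (0 : ℝ) 1) ∧ ∑ i, |x i| ≤ 1}

/-- The lattice points `k ∈ ℕ₀^d` with `k₁ + ⋯ + k_d ≤ m`, i.e. the lattice points of `m` times
the unit simplex. -/
def latticeSimplex (d m : ℕ) : Finset (Fin d → ℕ) :=
  (Fintype.piFinset fun _ : Fin d => Finset.range (m + 1)).filter fun k => ∑ i, k i ≤ m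

/-- The multinomial weights
`P_{k,m}(x) = m! / ((m - ‖k‖₁)! ∏ kᵢ!) * (1 - ‖x‖₁)^(m - ‖k‖₁) * ∏ xᵢ^kᵢ`.
They are used only for `‖k‖₁ ≤ m`, so that the subtraction is the true one. -/
noncomputable def multinomialWeight {d : ℕ} (m : ℕ) (k : Fin d → ℕ) (x : Fin d → ℝ) : ℝ :=
  (m.factorial : ℝ) / (((m - ∑ i, k i).factorial : ℝ) * ∏ i, ((k i).factorial : ℝ))
    * (1 - ∑ i, |x i|) ^ (m - ∑ i, k i) * ∏ i, x i ^ k i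

/-- The Bernstein polynomial of order `m` of a function `G` on the simplex. -/
noncomputable def bernsteinPoly {d : ℕ} (m : ℕ) (G : (Fin d → ℝ) → ℝ) (x : Fin d → ℝ) : ℝ :=
  ∑ k ∈ latticeSimplex d m, G (fun i => (k i : ℝ) / (m : ℝ)) * multinomialWeight m k x

/-- The joint c.d.f. `F(x) = μ((-∞, x])` of a law `μ` on `ℝ^d`; the order on `Fin d → ℝ` is the
componentwise one. -/
noncomputable def jointCDF {d : ℕ} (μ : Measure (Fin d → ℝ)) (x : Fin d → ℝ) : ℝ :=
  μ.real (Set.Iic x)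

/-- `X 0, X 1, X 2, …` are independent random vectors, defined on `(Ω, P)`, with law `μ`. -/
structure IsIIDSample {d : ℕ} {Ω : Type u} [MeasurableSpace Ω] (P : Measure Ω)
    (μ : Measure (Fin d → ℝ)) (X : ℕ → Ω → Fin d → ℝ) : Prop where
  measurable : ∀ i, Measurable (X i)
  law : ∀ i, P.map (X i) = μ
  indep : iIndepFun X P

/-- The empirical c.d.f. `F_n(x) = n⁻¹ ∑ 1_{(-∞,x]}(X_i)` of the first `n` observations
`X 0, …, X (n - 1)`. -/
noncomputable def empiricalCDF {d : ℕ} {Ω : Type u} (X : ℕ → Ω → Fin d → ℝ) (n : ℕ) (ω : Ω)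
    (x : Fin d → ℝ) : ℝ :=
  (n : ℝ)⁻¹ * ∑ i ∈ Finset.range n, (Set.Iic x).indicator (fun _ => (1 : ℝ)) (X i ω)

/-- The Bernstein estimator `F*_{n,m}`: the Bernstein polynomial of order `m` of the empirical
c.d.f. `F_n`. -/
noncomputable def bernsteinEstimator {d : ℕ} {Ω : Type u} (X : ℕ → Ω → Fin d → ℝ) (n m : ℕ)
    (ω : Ω) (x : Fin d → ℝ) : ℝ :=
  bernsteinPoly m (empiricalCDF X n ω) x

/-- `‖G‖_∞ = sup_{x ∈ S} |G x|` over the unit simplex `S`, for `G` bounded on `S`. -/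
noncomputable def simplexSupNorm {d : ℕ} (G : (Fin d → ℝ) → ℝ) : ℝ :=
  ⨆ x : unitSimplex d, |G x|

/-- `α_n = (n⁻¹ log n)^{1/2}`. -/
noncomputable def alphaRate (n : ℕ) : ℝ := Real.sqrt ((n : ℝ)⁻¹ * Real.log n)

/-- `β_{n,m} = α_n √α_m`. -/
noncomputable def betaRate (n m : ℕ) : ℝ := alphaRate n * Real.sqrt (alphaRate m)

/-! The weights `P_{k,m}(x)` form a multinomial distribution in `k`, so a Bernstein polynomial
averages its function at `k/m`, a random point with mean `x`. Their generating function has binomial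
marginals and yields an exponential moment bound, hence a variance of order `1/m` and Chernoff
tails. By linearity, with `H = F_n - F`, the estimator is `B_m H + B_m F`.

Consistency: `|B_m H| ≤ sup |H|` tends to `0` by Glivenko–Cantelli, and `B_m F → F` uniformly by
Chebyshev and uniform continuity. The first depends on `n` only and the second on `m` only, which
gives the joint limit.

Rate: write `F*_{n,m} - F_n = (B_m H - H) + (B_m F - F)`. In the second term the linear part of the
Taylor expansion averages to zero, leaving `O(1/m)`. In the first, Chernoff confines `k/m` to
distance `2 α_m` from `x` up to probability `O(1/m)` (`abs_bernsteinPoly_sub_le_of_modulus`), so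
only increments of `H` at that scale matter. Since `F` is Lipschitz, the two orthants differ by mass
`O(α_m)`; this is the variance in a Bernstein inequality, whence deviations of order `α_n √α_m =
β_{n,m}`. Bracketing reduces all increments to `m ^ (2 * d)` pairs of sets, the condition `β_{n,m} ≤
α_m` forces `m ≤ n ^ 6`, and Borel–Cantelli concludes
(`IsIIDSample.eventually_bracket_increment_le`). -/

/-! ### Multinomial weights: generating function, moments and tails. -/

theorem mem_latticeSimplex {d m : ℕ} {k : Fin d → ℕ} :
    k ∈ latticeSimplex d m ↔ ∑ i, k i ≤ m := by
  simp only [latticeSimplex, Finset.mem_filter, Fintype.mem_piFinset, Finset.mem_range,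
    and_iff_right_iff_imp]
  intro h i
  have := Finset.single_le_sum (f := k) (fun j _ => Nat.zero_le _) (Finset.mem_univ i)
  omega

theorem sum_abs_of_mem_unitSimplex {d : ℕ} {x : Fin d → ℝ} (hx : x ∈ unitSimplex d) :
    ∑ i, |x i| = ∑ i, x i :=
  Finset.sum_congr rfl fun i _ => abs_of_nonneg (hx.1 i).1

theorem multinomialWeight_eq_choose_mul {d m : ℕ} {k : Fin d → ℕ} (hk : ∑ i, k i ≤ m)
    (x : Fin d → ℝ) :
    multinomialWeight m k x = (m.choose (∑ i, k i) : ℝ) * (1 - ∑ i, |x i|) ^ (m - ∑ i, k i)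
      * (Nat.multinomial Finset.univ k * ∏ i, x i ^ k i) := by
  have h1 : (m.choose (∑ i, k i) : ℝ) * ((∑ i, k i).factorial : ℝ)
      * ((m - ∑ i, k i).factorial : ℝ) = (m.factorial : ℝ) := by
    exact_mod_cast Nat.choose_mul_factorial_mul_factorial hk
  have h2 : (∏ i, ((k i).factorial : ℝ)) * (Nat.multinomial Finset.univ k : ℝ)
      = ((∑ i, k i).factorial : ℝ) := by
    exact_mod_cast Nat.multinomial_spec Finset.univ k
  have h3 : (∏ i, ((k i).factorial : ℝ)) ≠ 0 :=
    Finset.prod_ne_zero_iff.2 fun i _ => by exact_mod_cast (k i).factorial_ne_zero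
  have h4 : ((m - ∑ i, k i).factorial : ℝ) ≠ 0 := by
    exact_mod_cast (m - ∑ i, k i).factorial_ne_zero
  rw [multinomialWeight, ← h1, ← h2]
  field_simp

/-- The generating function of the multinomial weights. -/
theorem sum_multinomialWeight_mul_prod_pow {d : ℕ} (m : ℕ) (x z : Fin d → ℝ) :
    ∑ k ∈ latticeSimplex d m, multinomialWeight m k x * ∏ i, z i ^ k i
      = (1 - ∑ i, |x i| + ∑ i, x i * z i) ^ m := by
  -- Group by total degree `j`: the binomial theorem handles the split between `j` and `m - j`, the
  -- multinomial theorem each fibre.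
  rw [add_comm, add_pow, ← Finset.sum_fiberwise_of_maps_to (s := latticeSimplex d m)
    (t := Finset.range (m + 1)) (g := fun k => ∑ i, k i)
    (fun k hk => Finset.mem_range.2 (Nat.lt_succ_of_le (mem_latticeSimplex.1 hk)))]
  refine Finset.sum_congr rfl fun j hj => ?_
  have hjm : j ≤ m := Nat.lt_succ_iff.1 (Finset.mem_range.1 hj)
  have hset : (latticeSimplex d m).filter (fun k => ∑ i, k i = j)
      = Finset.piAntidiag Finset.univ j := by
    ext k
    simp only [Finset.mem_filter, mem_latticeSimplex, Finset.mem_piAntidiag, Finset.mem_univ,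
      implies_true, and_true, and_iff_right_iff_imp]
    omega
  rw [hset, Finset.sum_pow_eq_sum_piAntidiag, Finset.sum_mul, Finset.sum_mul]
  refine Finset.sum_congr rfl fun k hk => ?_
  have hkj : ∑ i, k i = j := (Finset.mem_piAntidiag.1 hk).1
  rw [multinomialWeight_eq_choose_mul (hkj.trans_le hjm), hkj]
  simp only [mul_pow, Finset.prod_mul_distrib]
  ring

theorem multinomialWeight_nonneg {d m : ℕ} (k : Fin d → ℕ) {x : Fin d → ℝ}
    (hx : x ∈ unitSimplex d) : 0 ≤ multinomialWeight m k x := by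
  have h1 : 0 ≤ 1 - ∑ i, |x i| := sub_nonneg.2 hx.2
  have h2 : 0 ≤ ∏ i, x i ^ k i := Finset.prod_nonneg fun i _ => pow_nonneg (hx.1 i).1 _
  unfold multinomialWeight
  positivity

theorem sum_multinomialWeight {d : ℕ} (m : ℕ) {x : Fin d → ℝ} (hx : x ∈ unitSimplex d) :
    ∑ k ∈ latticeSimplex d m, multinomialWeight m k x = 1 := by
  have h := sum_multinomialWeight_mul_prod_pow m x (fun _ => 1)
  simpa [sum_abs_of_mem_unitSimplex hx] using h

/-- Each marginal of the multinomial weights is binomial. -/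
theorem sum_multinomialWeight_mul_pow {d : ℕ} (m : ℕ) {x : Fin d → ℝ} (hx : x ∈ unitSimplex d)
    (i : Fin d) (z : ℝ) :
    ∑ k ∈ latticeSimplex d m, multinomialWeight m k x * z ^ k i = (1 + x i * (z - 1)) ^ m := by
  have h := sum_multinomialWeight_mul_prod_pow m x (Function.update (fun _ => 1) i z)
  have h1 : ∀ k : Fin d → ℕ, ∏ j, Function.update (fun _ => (1 : ℝ)) i z j ^ k j = z ^ k i := by
    intro k
    rw [Finset.prod_eq_single i]
    · simp
    · intro j _ hj
      simp [hj]
    · simp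
  have h2 : ∑ j, x j * Function.update (fun _ => (1 : ℝ)) i z j
      = ∑ j, x j + x i * (z - 1) := by
    rw [← sub_eq_iff_eq_add', ← Finset.sum_sub_distrib, Finset.sum_eq_single i]
    · simp; ring
    · intro j _ hj
      simp [hj]
    · simp
  simp only [h1] at h
  rw [h, h2, sum_abs_of_mem_unitSimplex hx]
  ring

/-- Both sides are derivatives at `z = 1` of the marginal generating function. -/
theorem sum_multinomialWeight_mul_coord {d : ℕ} (m : ℕ) {x : Fin d → ℝ}
    (hx : x ∈ unitSimplex d) (i : Fin d) :
    ∑ k ∈ latticeSimplex d m, multinomialWeight m k x * (k i : ℝ) = m * x i := by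
  have h1 : HasDerivAt (fun z : ℝ => ∑ k ∈ latticeSimplex d m, multinomialWeight m k x * z ^ k i)
      (∑ k ∈ latticeSimplex d m, multinomialWeight m k x * (k i * (1 : ℝ) ^ (k i - 1))) 1 :=
    HasDerivAt.fun_sum fun k _ => (hasDerivAt_pow (k i) (1 : ℝ)).const_mul _
  have h2 : HasDerivAt (fun z : ℝ => (1 + x i * (z - 1)) ^ m)
      (m * (1 + x i * (1 - 1)) ^ (m - 1) * (x i * 1)) 1 :=
    ((((hasDerivAt_id (1 : ℝ)).sub_const 1).const_mul (x i)).const_add 1).pow m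
  simp only [sum_multinomialWeight_mul_pow m hx i] at h1
  simpa using h1.unique h2

theorem exp_le_one_add_add_sq {s : ℝ} (hs : |s| ≤ 1) : Real.exp s ≤ 1 + s + s ^ 2 := by
  have := (abs_le.1 (Real.abs_exp_sub_one_sub_id_le hs)).2
  linarith

/-- The binomial factor satisfies `1 + xᵢ (e^s - 1) ≤ 1 + xᵢ s + s² ≤ exp (xᵢ s + s²)`; in the
`m`-th power the centering cancels the linear term. -/
theorem sum_multinomialWeight_mul_exp_le {d : ℕ} (m : ℕ) {x : Fin d → ℝ}
    (hx : x ∈ unitSimplex d) (i : Fin d) {s : ℝ} (hs : |s| ≤ 1) :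
    ∑ k ∈ latticeSimplex d m, multinomialWeight m k x * Real.exp (s * (k i - m * x i))
      ≤ Real.exp (m * s ^ 2) := by
  have h0 := (hx.1 i).1
  have h1 := (hx.1 i).2
  have hterm : ∀ k : Fin d → ℕ, multinomialWeight m k x * Real.exp (s * (k i - m * x i))
      = multinomialWeight m k x * Real.exp s ^ k i * Real.exp (-(m * (s * x i))) := by
    intro k
    rw [← Real.exp_nat_mul, mul_assoc, ← Real.exp_add]
    ring_nf
  simp only [hterm]
  rw [← Finset.sum_mul, sum_multinomialWeight_mul_pow m hx i]
  have hb : 1 + x i * (Real.exp s - 1) ≤ Real.exp (x i * s + s ^ 2) := by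
    have h2 := exp_le_one_add_add_sq hs
    have h3 : x i * (Real.exp s - 1) ≤ x i * (s + s ^ 2) :=
      mul_le_mul_of_nonneg_left (by linarith) h0
    have h4 : x i * s ^ 2 ≤ s ^ 2 := mul_le_of_le_one_left (sq_nonneg s) h1
    have h5 := Real.add_one_le_exp (x i * s + s ^ 2)
    nlinarith
  have hb0 : 0 ≤ 1 + x i * (Real.exp s - 1) := by
    nlinarith [mul_nonneg h0 (Real.exp_pos s).le]
  calc (1 + x i * (Real.exp s - 1)) ^ m * Real.exp (-(m * (s * x i)))
      ≤ Real.exp (x i * s + s ^ 2) ^ m * Real.exp (-(m * (s * x i))) := by gcongr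
    _ = Real.exp (m * s ^ 2) := by
      rw [← Real.exp_nat_mul, ← Real.exp_add]
      ring_nf

/-- The right side is `(2 sinh (y/2))²`, and `|sinh u| ≥ |u|`. It lets exponential moments bound the
variance. -/
theorem sq_le_exp_add_exp_neg_sub_two (y : ℝ) : y ^ 2 ≤ Real.exp y + Real.exp (-y) - 2 := by
  have hsq : Real.exp y + Real.exp (-y) - 2 = (2 * Real.sinh (y / 2)) ^ 2 := by
    have h1 : Real.exp y = Real.exp (y / 2) ^ 2 := by rw [← Real.exp_nat_mul]; ring_nf
    have h2 : Real.exp (-y) = Real.exp (-(y / 2)) ^ 2 := by rw [← Real.exp_nat_mul]; ring_nf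
    have h3 : Real.exp (y / 2) * Real.exp (-(y / 2)) = 1 := by rw [← Real.exp_add]; simp
    rw [Real.sinh_eq, h1, h2]
    linear_combination 2 * h3
  rw [hsq, sq_le_sq]
  have habs : |y / 2| ≤ |Real.sinh (y / 2)| := by
    rw [Real.abs_sinh]
    exact Real.self_le_sinh_iff.2 (abs_nonneg _)
  rw [abs_mul, abs_two]
  rw [abs_div, abs_two] at habs
  linarith

/-- At `s = ±1/√m` both exponential moments are at most `e`, so the normalized second moment is at
most `2e - 2 ≤ 4`. -/
theorem sum_multinomialWeight_mul_sq_le {d m : ℕ} (hm : 1 ≤ m) {x : Fin d → ℝ}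
    (hx : x ∈ unitSimplex d) (i : Fin d) :
    ∑ k ∈ latticeSimplex d m, multinomialWeight m k x * ((k i : ℝ) / m - x i) ^ 2 ≤ 4 / m := by
  have hm0 : (0 : ℝ) < m := by exact_mod_cast hm
  have hm1 : (1 : ℝ) ≤ m := by exact_mod_cast hm
  set s : ℝ := 1 / Real.sqrt m with hs
  have hs2 : s ^ 2 = 1 / m := by rw [hs, div_pow, Real.sq_sqrt hm0.le, one_pow]
  have hs0 : 0 ≤ s := by positivity
  have hs1 : |s| ≤ 1 := by
    rw [abs_of_nonneg hs0]
    refine (sq_le_one_iff₀ hs0).1 ?_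
    rw [hs2, div_le_one hm0]
    exact hm1
  have h1 := sum_multinomialWeight_mul_exp_le m hx i hs1
  have h2 := sum_multinomialWeight_mul_exp_le m hx i (s := -s) (by rwa [abs_neg])
  have h3 : (m : ℝ) * s ^ 2 = 1 := by rw [hs2]; field_simp
  rw [neg_sq, h3] at h2
  rw [h3] at h1
  have hmain : ∑ k ∈ latticeSimplex d m,
      multinomialWeight m k x * (m * ((k i : ℝ) / m - x i) ^ 2) ≤ 4 := by
    calc ∑ k ∈ latticeSimplex d m, multinomialWeight m k x * (m * ((k i : ℝ) / m - x i) ^ 2)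
        ≤ ∑ k ∈ latticeSimplex d m, (multinomialWeight m k x * Real.exp (s * (k i - m * x i))
          + multinomialWeight m k x * Real.exp (-s * (k i - m * x i))
          - 2 * multinomialWeight m k x) := by
          refine Finset.sum_le_sum fun k _ => ?_
          have h4 := sq_le_exp_add_exp_neg_sub_two (s * (k i - m * x i))
          have h5 : (s * (k i - m * x i)) ^ 2 = m * ((k i : ℝ) / m - x i) ^ 2 := by
            rw [mul_pow, hs2]; field_simp
          rw [h5, ← neg_mul] at h4
          have := mul_le_mul_of_nonneg_left h4 (multinomialWeight_nonneg (m := m) k hx)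
          linarith
      _ ≤ 4 := by
          rw [Finset.sum_sub_distrib, Finset.sum_add_distrib, ← Finset.mul_sum,
            sum_multinomialWeight m hx]
          have := Real.exp_one_lt_d9
          linarith
  rw [le_div_iff₀ hm0, Finset.sum_mul]
  refine le_trans (le_of_eq (Finset.sum_congr rfl fun k _ => ?_)) hmain
  ring

/-- Chernoff bound for the multinomial weights. -/
theorem sum_multinomialWeight_filter_le {d m : ℕ} {x : Fin d → ℝ} (hx : x ∈ unitSimplex d)
    (i : Fin d) {s : ℝ} (hs0 : 0 ≤ s) (hs1 : s ≤ 1) :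
    ∑ k ∈ (latticeSimplex d m).filter (fun k => 2 * s * m < |(k i : ℝ) - m * x i|),
      multinomialWeight m k x ≤ 2 * Real.exp (-(m * s ^ 2)) := by
  have hs : |s| ≤ 1 := by rwa [abs_of_nonneg hs0]
  have h1 := sum_multinomialWeight_mul_exp_le m hx i hs
  have h2 := sum_multinomialWeight_mul_exp_le m hx i (s := -s) (by rwa [abs_neg])
  rw [neg_sq] at h2
  -- On the event, one of `exp (± s (kᵢ - m xᵢ))` exceeds `exp (2 m s²)`, so multiplying their sum
  -- by `E` dominates the indicator.
  set E := Real.exp (-(2 * (m * s ^ 2))) with hE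
  have hw := fun k => multinomialWeight_nonneg (m := m) k hx
  calc ∑ k ∈ (latticeSimplex d m).filter (fun k => 2 * s * m < |(k i : ℝ) - m * x i|),
      multinomialWeight m k x
      ≤ ∑ k ∈ (latticeSimplex d m).filter (fun k => 2 * s * m < |(k i : ℝ) - m * x i|),
        (multinomialWeight m k x * Real.exp (s * (k i - m * x i))
          + multinomialWeight m k x * Real.exp (-s * (k i - m * x i))) * E := by
        refine Finset.sum_le_sum fun k hk => ?_
        have hk2 := (Finset.mem_filter.1 hk).2
        rw [← mul_add, mul_assoc]
        refine le_mul_of_one_le_right (hw k) ?_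
        rw [add_mul, hE, ← Real.exp_add, ← Real.exp_add]
        rcases lt_abs.1 hk2 with h | h
        · have : 0 ≤ s * (k i - m * x i) + -(2 * (m * s ^ 2)) := by nlinarith
          linarith [Real.one_le_exp this,
            Real.exp_pos (-s * (k i - m * x i) + -(2 * (m * s ^ 2)))]
        · have : 0 ≤ -s * (k i - m * x i) + -(2 * (m * s ^ 2)) := by nlinarith
          linarith [Real.one_le_exp this,
            Real.exp_pos (s * (k i - m * x i) + -(2 * (m * s ^ 2)))]
    _ ≤ ∑ k ∈ latticeSimplex d m, (multinomialWeight m k x * Real.exp (s * (k i - m * x i))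
          + multinomialWeight m k x * Real.exp (-s * (k i - m * x i))) * E := by
        refine Finset.sum_le_sum_of_subset_of_nonneg (Finset.filter_subset _ _) fun k _ _ => ?_
        have := hw k
        positivity
    _ ≤ (Real.exp (m * s ^ 2) + Real.exp (m * s ^ 2)) * E := by
        rw [← Finset.sum_mul, Finset.sum_add_distrib]
        gcongr
    _ = 2 * Real.exp (-(m * s ^ 2)) := by
        rw [hE, ← two_mul, mul_assoc, ← Real.exp_add]
        ring_nf

theorem lattice_div_mem_unitSimplex {d m : ℕ} (hm : 1 ≤ m) {k : Fin d → ℕ}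
    (hk : k ∈ latticeSimplex d m) : (fun i => (k i : ℝ) / (m : ℝ)) ∈ unitSimplex d := by
  have hm0 : (0 : ℝ) < m := by exact_mod_cast hm
  have hk' := mem_latticeSimplex.1 hk
  refine ⟨fun i => ⟨by positivity, ?_⟩, ?_⟩
  · have := Finset.single_le_sum (f := k) (fun j _ => Nat.zero_le _) (Finset.mem_univ i)
    rw [div_le_one hm0]
    exact_mod_cast this.trans hk'
  · have : ∀ i, |(k i : ℝ) / m| = (k i : ℝ) / m := fun i => abs_of_nonneg (by positivity)
    simp only [this]
    rw [← Finset.sum_div, div_le_one hm0]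
    exact_mod_cast hk'

theorem bernsteinPoly_sub_const {d : ℕ} (m : ℕ) (G : (Fin d → ℝ) → ℝ) (c : ℝ) {x : Fin d → ℝ}
    (hx : x ∈ unitSimplex d) :
    bernsteinPoly m G x - c = ∑ k ∈ latticeSimplex d m,
      (G (fun i => (k i : ℝ) / (m : ℝ)) - c) * multinomialWeight m k x := by
  simp only [sub_mul, Finset.sum_sub_distrib]
  rw [← Finset.mul_sum, sum_multinomialWeight m hx, mul_one, bernsteinPoly]

theorem abs_sum_mul_multinomialWeight_le {d m : ℕ} {x : Fin d → ℝ} (hx : x ∈ unitSimplex d)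
    (f : (Fin d → ℕ) → ℝ) :
    |∑ k ∈ latticeSimplex d m, f k * multinomialWeight m k x|
      ≤ ∑ k ∈ latticeSimplex d m, |f k| * multinomialWeight m k x := by
  refine (Finset.abs_sum_le_sum_abs _ _).trans (le_of_eq (Finset.sum_congr rfl fun k _ => ?_))
  rw [abs_mul, abs_of_nonneg (multinomialWeight_nonneg k hx)]

/-! ### Quantiles and bracketing of orthants. -/

/-- A quantile of a probability measure on the line. -/
theorem exists_quantile (ν : Measure ℝ) [IsProbabilityMeasure ν] {u : ℝ} (hu0 : 0 < u)
    (hu1 : u < 1) :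
    ∃ q : ℝ, u ≤ ν.real (Set.Iic q) ∧ ν.real (Set.Iio q) ≤ u ∧
      ∀ x, u ≤ ν.real (Set.Iic x) ↔ q ≤ x := by
  have hmono := monotone_cdf ν
  set T := {t : ℝ | u ≤ cdf ν t} with hT
  have hne : T.Nonempty :=
    (((tendsto_cdf_atTop ν).eventually (eventually_ge_nhds hu1)).exists)
  obtain ⟨b, hb⟩ := ((tendsto_cdf_atBot ν).eventually (eventually_lt_nhds hu0)).exists
  have hbdd : BddBelow T := ⟨b, fun t ht => by
    by_contra hlt
    exact absurd (ht.trans (hmono (not_le.1 hlt).le)) (not_le.2 hb)⟩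
  -- Right continuity makes the infimum a member of `T`.
  have hq : u ≤ cdf ν (sInf T) := by
    have hright : Tendsto (cdf ν) (𝓝[>] (sInf T)) (𝓝 (cdf ν (sInf T))) :=
      ((cdf ν).right_continuous (sInf T)).mono_left (nhdsWithin_mono _ Set.Ioi_subset_Ici_self)
    refine ge_of_tendsto hright ?_
    filter_upwards [self_mem_nhdsWithin] with t ht
    obtain ⟨s, hs, hst⟩ := exists_lt_of_csInf_lt hne ht
    exact le_trans hs (hmono hst.le)
  have hiff : ∀ x, u ≤ cdf ν x ↔ sInf T ≤ x := fun x =>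
    ⟨fun h => csInf_le hbdd h, fun h => hq.trans (hmono h)⟩
  refine ⟨sInf T, by rwa [← cdf_eq_real], ?_, fun x => by rw [← cdf_eq_real]; exact hiff x⟩
  have hIio : ν (Set.Iio (sInf T)) = ENNReal.ofReal (Function.leftLim (cdf ν) (sInf T) - 0) := by
    conv_lhs => rw [← measure_cdf ν]
    exact (cdf ν).measure_Iio (tendsto_cdf_atBot ν) _
  have hle : Function.leftLim (cdf ν) (sInf T) ≤ u := by
    refine le_of_tendsto (hmono.tendsto_leftLim (sInf T)) ?_
    filter_upwards [self_mem_nhdsWithin] with t ht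
    by_contra hlt
    exact absurd ((hiff t).1 (not_le.1 hlt).le) (not_le.2 ht)
  rw [Measure.real, hIio, sub_zero]
  exact ENNReal.toReal_le_of_le_ofReal hu0.le (ENNReal.ofReal_le_ofReal hle)

/-- The half-lines `Iic x` can be bracketed up to mass `1 / N` by `N` pairs of sets. -/
theorem exists_bracket_Iic_real (ν : Measure ℝ) [IsProbabilityMeasure ν] {N : ℕ} (hN : 1 ≤ N) :
    ∃ A B : Fin N → Set ℝ, (∀ j, MeasurableSet (A j)) ∧ (∀ j, MeasurableSet (B j)) ∧
      ∀ x, ∃ j, A j ⊆ Set.Iic x ∧ Set.Iic x ⊆ B j ∧ ν.real (B j \ A j) ≤ 1 / N := by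
  have hN0 : (0 : ℝ) < N := by exact_mod_cast hN
  have hquant : ∀ j : ℕ, ∃ q : ℝ, 0 < j → j < N → (j : ℝ) / N ≤ ν.real (Set.Iic q) ∧
      ν.real (Set.Iio q) ≤ (j : ℝ) / N ∧
      ∀ x, (j : ℝ) / N ≤ ν.real (Set.Iic x) ↔ q ≤ x := by
    intro j
    by_cases hj : 0 < j ∧ j < N
    · obtain ⟨q, hq⟩ := exists_quantile ν (u := (j : ℝ) / N)
        (div_pos (by exact_mod_cast hj.1) hN0)
        ((div_lt_one hN0).2 (by exact_mod_cast hj.2))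
      exact ⟨q, fun _ _ => hq⟩
    · exact ⟨0, fun h1 h2 => absurd ⟨h1, h2⟩ hj⟩
  choose q hq using hquant
  set A : ℕ → Set ℝ := fun j => if j = 0 then ∅ else Set.Iic (q j) with hA
  -- The upper bracket is open at the next quantile, so an atom there does not count; this keeps the
  -- gap at `1 / N` without continuity of `ν`.
  set B : ℕ → Set ℝ := fun j => if j + 1 < N then Set.Iio (q (j + 1)) else Set.univ with hB
  have hAm : ∀ j, MeasurableSet (A j) := by
    intro j
    simp only [hA]
    split_ifs
    exacts [MeasurableSet.empty, measurableSet_Iic]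
  have hBm : ∀ j, MeasurableSet (B j) := by
    intro j
    simp only [hB]
    split_ifs
    exacts [measurableSet_Iio, MeasurableSet.univ]
  refine ⟨fun j => A j, fun j => B j, fun j => hAm j, fun j => hBm j, fun x => ?_⟩
  set u := ν.real (Set.Iic x) with hu
  have hu0 : 0 ≤ u := measureReal_nonneg
  -- The minimum matters only at `u = 1`, where the floor would be `N`.
  set j := min ⌊N * u⌋₊ (N - 1) with hj
  have hjN : j < N := by omega
  have hj1 : (j : ℝ) / N ≤ u := by
    rw [div_le_iff₀ hN0, mul_comm]
    exact (Nat.cast_le.2 (min_le_left _ _)).trans (Nat.floor_le (by positivity))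
  have hj2 : j + 1 < N → u < ((j + 1 : ℕ) : ℝ) / N := by
    intro h
    have : j = ⌊N * u⌋₊ := by omega
    rw [lt_div_iff₀ hN0, mul_comm, this]
    exact_mod_cast Nat.lt_floor_add_one (N * u)
  have hAx : A j ⊆ Set.Iic x := by
    simp only [hA]
    split_ifs with h
    · exact Set.empty_subset _
    · exact Set.Iic_subset_Iic.2 (((hq j (Nat.pos_of_ne_zero h) hjN).2.2 x).1 hj1)
  have hBx : Set.Iic x ⊆ B j := by
    simp only [hB]
    split_ifs with h
    · refine Set.Iic_subset_Iio.2 (not_le.1 fun hle => ?_)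
      exact absurd (((hq (j + 1) (Nat.succ_pos j) h).2.2 x).2 hle) (not_le.2 (hj2 h))
    · exact Set.subset_univ _
  have hAmass : (j : ℝ) / N ≤ ν.real (A j) := by
    simp only [hA]
    split_ifs with h
    · simp [h]
    · exact (hq j (Nat.pos_of_ne_zero h) hjN).1
  have hBmass : ν.real (B j) ≤ ((j : ℝ) + 1) / N := by
    simp only [hB]
    split_ifs with h
    · exact_mod_cast (hq (j + 1) (Nat.succ_pos j) h).2.1
    · have h1 : (N : ℝ) ≤ j + 1 := by exact_mod_cast not_lt.1 h
      rw [probReal_univ, le_div_iff₀ hN0]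
      linarith
  refine ⟨⟨j, hjN⟩, hAx, hBx, ?_⟩
  rw [measureReal_sdiff (hAx.trans hBx) (hAm j)]
  have : ((j : ℝ) + 1) / N = (j : ℝ) / N + 1 / N := add_div _ _ _
  linarith

/-- The orthants `Iic x` of `ℝ^d` can be bracketed up to mass `d / N` by `N ^ d` pairs of sets. -/
theorem exists_bracket_Iic {d : ℕ} (μ : Measure (Fin d → ℝ)) [IsProbabilityMeasure μ] {N : ℕ}
    (hN : 1 ≤ N) :
    ∃ A B : (Fin d → Fin N) → Set (Fin d → ℝ), (∀ j, MeasurableSet (A j)) ∧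
      (∀ j, MeasurableSet (B j)) ∧
      ∀ x, ∃ j, A j ⊆ Set.Iic x ∧ Set.Iic x ⊆ B j ∧ μ.real (B j \ A j) ≤ d / N := by
  have hprob : ∀ i : Fin d, IsProbabilityMeasure (μ.map fun x => x i) := fun i =>
    Measure.isProbabilityMeasure_map (measurable_pi_apply i).aemeasurable
  choose A B hA hB hAB using fun i : Fin d => exists_bracket_Iic_real (μ.map fun x => x i) hN
  refine ⟨fun j => Set.univ.pi fun i => A i (j i), fun j => Set.univ.pi fun i => B i (j i),
    fun j => MeasurableSet.univ_pi fun i => hA i _, fun j => MeasurableSet.univ_pi fun i => hB i _,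
    fun x => ?_⟩
  choose j hjA hjB hj using fun i => hAB i (x i)
  refine ⟨j, ?_, ?_, ?_⟩
  · rw [← Set.pi_univ_Iic]
    exact Set.pi_mono fun i _ => hjA i
  · rw [← Set.pi_univ_Iic]
    exact Set.pi_mono fun i _ => hjB i
  -- A point of the outer box outside the inner one fails in some coordinate, so the gap is at most
  -- the sum of the `d` marginal gaps.
  · have hsub : (Set.univ.pi fun i => B i (j i)) \ (Set.univ.pi fun i => A i (j i))
        ⊆ ⋃ i : Fin d, (fun y : Fin d → ℝ => y i) ⁻¹' (B i (j i) \ A i (j i)) := by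
      rintro y ⟨hyB, hyA⟩
      simp only [Set.mem_univ_pi, not_forall] at hyA hyB
      obtain ⟨i, hi⟩ := hyA
      exact Set.mem_iUnion.2 ⟨i, hyB i, hi⟩
    calc μ.real ((Set.univ.pi fun i => B i (j i)) \ (Set.univ.pi fun i => A i (j i)))
        ≤ μ.real (⋃ i : Fin d, (fun y : Fin d → ℝ => y i) ⁻¹' (B i (j i) \ A i (j i))) :=
          measureReal_mono hsub
      _ ≤ ∑ i : Fin d, μ.real ((fun y : Fin d → ℝ => y i) ⁻¹' (B i (j i) \ A i (j i))) :=
          measureReal_iUnion_fintype_le _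
      _ ≤ ∑ _i : Fin d, (1 : ℝ) / N := by
          refine Finset.sum_le_sum fun i _ => ?_
          rw [← map_measureReal_apply (measurable_pi_apply i) ((hB i _).diff (hA i _))]
          exact hj i
      _ = d / N := by simp [div_eq_mul_inv]

/-! ### Concentration of frequencies and Glivenko–Cantelli. -/

/-- The frequency of `A` among the first `n` observations. -/
noncomputable def empiricalFreq {E Ω : Type*} (X : ℕ → Ω → E) (n : ℕ) (ω : Ω) (A : Set E) : ℝ :=
  (n : ℝ)⁻¹ * ∑ i ∈ Finset.range n, A.indicator (fun _ => (1 : ℝ)) (X i ω)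

theorem empiricalFreq_mono {E Ω : Type*} (X : ℕ → Ω → E) (n : ℕ) (ω : Ω) {A B : Set E}
    (h : A ⊆ B) : empiricalFreq X n ω A ≤ empiricalFreq X n ω B := by
  refine mul_le_mul_of_nonneg_left (Finset.sum_le_sum fun i _ => ?_) (by positivity)
  exact Set.indicator_le_indicator_of_subset h (fun _ => zero_le_one) _

/-- A Bernstein-type inequality for the mean of bounded i.i.d. variables. -/
theorem IsIIDSample.measureReal_le_mean_sub_integral {d : ℕ} {Ω : Type u} [MeasurableSpace Ω]
    {P : Measure Ω} [IsProbabilityMeasure P] {μ : Measure (Fin d → ℝ)} [IsProbabilityMeasure μ]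
    {X : ℕ → Ω → Fin d → ℝ} (hX : IsIIDSample P μ X) {f : (Fin d → ℝ) → ℝ} (hf : Measurable f)
    (hf1 : ∀ y, |f y| ≤ 1) {v t : ℝ} (hv : ∫ y, f y ^ 2 ∂μ ≤ v) (ht0 : 0 ≤ t) (ht1 : t ≤ 1)
    (s : ℝ) {n : ℕ} (hn : 1 ≤ n) :
    P.real {ω | s ≤ (n : ℝ)⁻¹ * ∑ i ∈ Finset.range n, f (X i ω) - ∫ y, f y ∂μ}
      ≤ Real.exp (n * (t ^ 2 * v - t * s)) := by
  have hn0 : (0 : ℝ) < n := by exact_mod_cast hn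
  set e := ∫ y, f y ∂μ with he
  set Y : ℕ → Ω → ℝ := fun i ω => f (X i ω) with hY
  have hYm : ∀ i, Measurable (Y i) := fun i => hf.comp (hX.measurable i)
  have hindep : iIndepFun Y P := hX.indep.comp (fun _ => f) (fun _ => hf)
  have hbound : ∀ y, |t * f y| ≤ 1 := fun y => by
    rw [abs_mul, abs_of_nonneg ht0]
    exact mul_le_one₀ ht1 (abs_nonneg _) (hf1 y)
  have hintf : Integrable f μ :=
    Integrable.of_bound hf.aestronglyMeasurable 1 (ae_of_all _ fun y => hf1 y)
  have hintf2 : Integrable (fun y => f y ^ 2) μ :=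
    Integrable.of_bound (hf.pow_const 2).aestronglyMeasurable 1 (ae_of_all _ fun y => by
      rw [Real.norm_eq_abs, abs_pow]
      exact pow_le_one₀ (abs_nonneg _) (hf1 y))
  have hmgf : ∀ i, mgf (Y i) P t ≤ Real.exp (t * e + t ^ 2 * v) := by
    intro i
    have h1 : mgf (Y i) P t = ∫ y, Real.exp (t * f y) ∂μ := by
      rw [mgf, ← hX.law i, integral_map (hX.measurable i).aemeasurable]
      exact (Real.measurable_exp.comp (hf.const_mul t)).aestronglyMeasurable
    rw [h1]
    -- The quadratic bound on `exp` needs `|t f| ≤ 1` and brings in the second moment `v`; a bound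
    -- on the range of `f` alone would lose the factor `√α_m` in the rate.
    calc ∫ y, Real.exp (t * f y) ∂μ ≤ ∫ y, (1 + t * f y + t ^ 2 * f y ^ 2) ∂μ := by
          refine integral_mono ?_ (((integrable_const _).add (hintf.const_mul t)).add
            (hintf2.const_mul _)) fun y => ?_
          · refine Integrable.of_bound
              (Real.measurable_exp.comp (hf.const_mul t)).aestronglyMeasurable (Real.exp 1)
              (ae_of_all _ fun y => ?_)
            rw [Real.norm_eq_abs, Real.abs_exp]
            exact Real.exp_le_exp.2 ((le_abs_self _).trans (hbound y))
          · have := exp_le_one_add_add_sq (hbound y)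
            rwa [mul_pow] at this
      _ = 1 + t * e + t ^ 2 * ∫ y, f y ^ 2 ∂μ := by
          have hint : Integrable (fun y => 1 + t * f y) μ :=
            (integrable_const _).add (hintf.const_mul t)
          rw [integral_add hint (hintf2.const_mul _),
            integral_add (integrable_const _) (hintf.const_mul t), integral_const_mul,
            integral_const_mul]
          simp [he]
      _ ≤ 1 + (t * e + t ^ 2 * v) := by nlinarith [mul_le_mul_of_nonneg_left hv (sq_nonneg t)]
      _ ≤ Real.exp (t * e + t ^ 2 * v) := by
          rw [add_comm]
          exact Real.add_one_le_exp _
  set Z : Ω → ℝ := ∑ i ∈ Finset.range n, Y i with hZ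
  have hZbound : ∀ ω, |Z ω| ≤ n := by
    intro ω
    rw [hZ, Finset.sum_apply]
    refine (Finset.abs_sum_le_sum_abs _ _).trans ?_
    refine (Finset.sum_le_sum fun i _ => hf1 (X i ω)).trans ?_
    simp
  have hZm : Measurable Z := by
    rw [show Z = fun ω => ∑ i ∈ Finset.range n, Y i ω from funext fun ω => Finset.sum_apply _ _ _]
    exact Finset.measurable_sum _ fun i _ => hYm i
  have hZint : Integrable (fun ω => Real.exp (t * Z ω)) P := by
    refine Integrable.of_bound
      (Real.measurable_exp.comp (hZm.const_mul t)).aestronglyMeasurable (Real.exp (t * n))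
      (ae_of_all _ fun ω => ?_)
    rw [Real.norm_eq_abs, Real.abs_exp]
    exact Real.exp_le_exp.2 (mul_le_mul_of_nonneg_left ((le_abs_self _).trans (hZbound ω)) ht0)
  have hset : {ω | s ≤ (n : ℝ)⁻¹ * ∑ i ∈ Finset.range n, f (X i ω) - e}
      = {ω | n * (s + e) ≤ Z ω} := by
    ext ω
    simp only [Set.mem_ofPred_eq, hZ, Finset.sum_apply, hY]
    rw [le_sub_iff_add_le, inv_mul_eq_div, le_div_iff₀ hn0, mul_comm]
  rw [hset]
  refine (measure_ge_le_exp_mul_mgf _ ht0 hZint).trans ?_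
  rw [hZ, hindep.mgf_sum hYm]
  calc Real.exp (-t * (n * (s + e))) * ∏ i ∈ Finset.range n, mgf (Y i) P t
      ≤ Real.exp (-t * (n * (s + e))) * ∏ _i ∈ Finset.range n, Real.exp (t * e + t ^ 2 * v) := by
        gcongr with i
        · exact fun i _ => mgf_nonneg
        · exact hmgf i
    _ = Real.exp (n * (t ^ 2 * v - t * s)) := by
        rw [Finset.prod_const, Finset.card_range, ← Real.exp_nat_mul, ← Real.exp_add]
        ring_nf

/-- For `f = 1_B - 1_A` the square `f²` is the indicator of the symmetric difference, whose mass
therefore serves as the variance. -/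
theorem IsIIDSample.measureReal_le_empiricalFreq_sub {d : ℕ} {Ω : Type u} [MeasurableSpace Ω]
    {P : Measure Ω} [IsProbabilityMeasure P] {μ : Measure (Fin d → ℝ)} [IsProbabilityMeasure μ]
    {X : ℕ → Ω → Fin d → ℝ} (hX : IsIIDSample P μ X) {A B : Set (Fin d → ℝ)}
    (hA : MeasurableSet A) (hB : MeasurableSet B) {v t : ℝ} (hv : μ.real (symmDiff A B) ≤ v)
    (ht0 : 0 ≤ t) (ht1 : t ≤ 1) (s : ℝ) {n : ℕ} (hn : 1 ≤ n) :
    P.real {ω | s ≤ (empiricalFreq X n ω B - empiricalFreq X n ω A) - (μ.real B - μ.real A)}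
      ≤ Real.exp (n * (t ^ 2 * v - t * s)) := by
  set f : (Fin d → ℝ) → ℝ :=
    fun y => B.indicator (fun _ => (1 : ℝ)) y - A.indicator (fun _ => (1 : ℝ)) y with hf
  have hiA : Integrable (A.indicator fun _ => (1 : ℝ)) μ := (integrable_const _).indicator hA
  have hiB : Integrable (B.indicator fun _ => (1 : ℝ)) μ := (integrable_const _).indicator hB
  have hfm : Measurable f :=
    (measurable_const.indicator hB).sub (measurable_const.indicator hA)
  have hf1 : ∀ y, |f y| ≤ 1 := by
    intro y
    by_cases h1 : y ∈ A <;> by_cases h2 : y ∈ B <;> simp [hf, h1, h2]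
  have hsq : (fun y => f y ^ 2) = (symmDiff A B).indicator fun _ => (1 : ℝ) := by
    ext y
    by_cases h1 : y ∈ A <;> by_cases h2 : y ∈ B <;>
      simp [hf, h1, h2, Set.indicator, Set.mem_symmDiff]
  have hv' : ∫ y, f y ^ 2 ∂μ ≤ v := by
    rw [hsq, integral_indicator_const _ (hA.symmDiff hB)]
    simpa using hv
  have hint : ∫ y, f y ∂μ = μ.real B - μ.real A := by
    rw [hf, integral_sub hiB hiA, integral_indicator_const _ hA, integral_indicator_const _ hB]
    simp
  have h := hX.measureReal_le_mean_sub_integral hfm hf1 hv' ht0 ht1 s hn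
  rw [hint] at h
  convert h using 5
  simp only [empiricalFreq, hf, Finset.sum_sub_distrib]
  ring

/-- The strong law of large numbers for frequencies. -/
theorem IsIIDSample.tendsto_empiricalFreq {d : ℕ} {Ω : Type u} [MeasurableSpace Ω]
    {P : Measure Ω} [IsProbabilityMeasure P] {μ : Measure (Fin d → ℝ)}
    {X : ℕ → Ω → Fin d → ℝ} (hX : IsIIDSample P μ X) {A : Set (Fin d → ℝ)}
    (hA : MeasurableSet A) :
    ∀ᵐ ω ∂P, Tendsto (fun n => empiricalFreq X n ω A) atTop (𝓝 (μ.real A)) := by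
  set f : (Fin d → ℝ) → ℝ := A.indicator fun _ => (1 : ℝ) with hf
  have hfm : Measurable f := measurable_const.indicator hA
  have hint : Integrable (fun ω => f (X 0 ω)) P := by
    refine Integrable.of_bound (hfm.comp (hX.measurable 0)).aestronglyMeasurable 1
      (ae_of_all _ fun ω => ?_)
    by_cases h : X 0 ω ∈ A <;> simp [hf, h]
  have h := strong_law_ae_real (μ := P) (fun i ω => f (X i ω)) hint
    (fun i j hij => (hX.indep.comp (fun _ => f) (fun _ => hfm)).indepFun hij)
    (fun i => ({ aemeasurable_fst := (hX.measurable i).aemeasurable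
                 aemeasurable_snd := (hX.measurable 0).aemeasurable
                 map_eq := by rw [hX.law, hX.law] } : IdentDistrib (X i) (X 0) P P).comp hfm)
  have he : ∫ ω, f (X 0 ω) ∂P = μ.real A := by
    rw [← integral_map (hX.measurable 0).aemeasurable hfm.aestronglyMeasurable, hX.law, hf,
      integral_indicator_const _ hA]
    simp
  rw [he] at h
  filter_upwards [h] with ω hω
  refine hω.congr fun n => ?_
  rw [empiricalFreq, div_eq_inv_mul]

theorem empiricalCDF_eq_empiricalFreq {d : ℕ} {Ω : Type u} (X : ℕ → Ω → Fin d → ℝ) (n : ℕ)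
    (ω : Ω) (x : Fin d → ℝ) : empiricalCDF X n ω x = empiricalFreq X n ω (Set.Iic x) := rfl

/-- The Glivenko–Cantelli theorem in `ℝ^d`. -/
theorem IsIIDSample.glivenko_cantelli {d : ℕ} {Ω : Type u} [MeasurableSpace Ω]
    {P : Measure Ω} [IsProbabilityMeasure P] {μ : Measure (Fin d → ℝ)} [IsProbabilityMeasure μ]
    {X : ℕ → Ω → Fin d → ℝ} (hX : IsIIDSample P μ X) :
    ∀ᵐ ω ∂P, ∀ ε > 0, ∀ᶠ n in atTop, ∀ x, |empiricalCDF X n ω x - jointCDF μ x| ≤ ε := by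
  choose A B hA hB hAB using fun N : ℕ => exists_bracket_Iic μ (N := N + 1) (Nat.le_add_left 1 N)
  -- Only countably many bracketing sets occur, so one null set serves every precision.
  have h1 : ∀ᵐ ω ∂P, ∀ N j, Tendsto (fun n => empiricalFreq X n ω (A N j)) atTop
      (𝓝 (μ.real (A N j))) :=
    ae_all_iff.2 fun N => ae_all_iff.2 fun j => hX.tendsto_empiricalFreq (hA N j)
  have h2 : ∀ᵐ ω ∂P, ∀ N j, Tendsto (fun n => empiricalFreq X n ω (B N j)) atTop
      (𝓝 (μ.real (B N j))) :=
    ae_all_iff.2 fun N => ae_all_iff.2 fun j => hX.tendsto_empiricalFreq (hB N j)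
  filter_upwards [h1, h2] with ω h1 h2 ε hε
  obtain ⟨N, hN⟩ : ∃ N : ℕ, (d : ℝ) / ((N + 1 : ℕ) : ℝ) ≤ ε / 2 := by
    have : Tendsto (fun N : ℕ => (d : ℝ) / ((N + 1 : ℕ) : ℝ)) atTop (𝓝 0) :=
      (tendsto_const_div_atTop_nhds_zero_nat (d : ℝ)).comp (tendsto_add_atTop_nat 1)
    exact (this.eventually (eventually_le_nhds (half_pos hε))).exists
  have e1 : ∀ᶠ n in atTop, ∀ j, |empiricalFreq X n ω (A N j) - μ.real (A N j)| ≤ ε / 2 :=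
    eventually_all.2 fun j => ((h1 N j).eventually (Metric.closedBall_mem_nhds _ (half_pos hε)))
  have e2 : ∀ᶠ n in atTop, ∀ j, |empiricalFreq X n ω (B N j) - μ.real (B N j)| ≤ ε / 2 :=
    eventually_all.2 fun j => ((h2 N j).eventually (Metric.closedBall_mem_nhds _ (half_pos hε)))
  filter_upwards [e1, e2] with n e1 e2 x
  obtain ⟨j, hjA, hjB, hj⟩ := hAB N x
  rw [measureReal_sdiff (hjA.trans hjB) (hA N j)] at hj
  have m1 := empiricalFreq_mono X n ω hjA
  have m2 := empiricalFreq_mono X n ω hjB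
  have m3 : μ.real (A N j) ≤ μ.real (Set.Iic x) := measureReal_mono hjA
  have m4 : μ.real (Set.Iic x) ≤ μ.real (B N j) := measureReal_mono hjB
  have a1 := abs_le.1 (e1 j)
  have a2 := abs_le.1 (e2 j)
  rw [empiricalCDF_eq_empiricalFreq, jointCDF, abs_le]
  constructor <;> linarith [a1.1, a1.2, a2.1, a2.2]

/-! ### Geometry of the simplex and the supremum norm. -/

theorem convex_unitSimplex (d : ℕ) : Convex ℝ (unitSimplex d) := by
  intro x hx y hy a b ha hb hab
  have hbox : Convex ℝ {x : Fin d → ℝ | ∀ i, x i ∈ Set.Icc (0 : ℝ) 1} := by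
    have : {x : Fin d → ℝ | ∀ i, x i ∈ Set.Icc (0 : ℝ) 1}
        = Set.univ.pi fun _ => Set.Icc (0 : ℝ) 1 := by
      ext
      simp only [Set.mem_univ_pi, Set.mem_ofPred_eq]
    rw [this]
    exact convex_pi fun i _ => convex_Icc 0 1
  have hmem := hbox hx.1 hy.1 ha hb hab
  refine ⟨hmem, ?_⟩
  have h1 := sum_abs_of_mem_unitSimplex hx ▸ hx.2
  have h2 := sum_abs_of_mem_unitSimplex hy ▸ hy.2
  rw [Finset.sum_congr rfl fun i _ => abs_of_nonneg (hmem i).1]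
  simp only [Pi.add_apply, Pi.smul_apply, smul_eq_mul, Finset.sum_add_distrib, ← Finset.mul_sum]
  nlinarith

theorem isCompact_unitSimplex (d : ℕ) : IsCompact (unitSimplex d) := by
  have : unitSimplex d = (Set.univ.pi fun _ => Set.Icc (0 : ℝ) 1) ∩ {x | ∑ i, |x i| ≤ 1} := by
    ext
    simp only [unitSimplex, Set.mem_univ_pi, Set.mem_inter_iff, Set.mem_ofPred_eq]
  rw [this]
  refine (isCompact_univ_pi fun _ => isCompact_Icc).inter_right (isClosed_le ?_ continuous_const)
  fun_prop

theorem zero_mem_unitSimplex (d : ℕ) : (0 : Fin d → ℝ) ∈ unitSimplex d := by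
  simp [unitSimplex]

/-- Needed to keep `Iic x ∩ Iic y = Iic (x ⊓ y)` within the region where the c.d.f. is Lipschitz. -/
theorem inf_mem_unitSimplex {d : ℕ} {x y : Fin d → ℝ} (hx : x ∈ unitSimplex d)
    (hy : y ∈ unitSimplex d) : x ⊓ y ∈ unitSimplex d := by
  have h0 : ∀ i, 0 ≤ (x ⊓ y) i := fun i => le_inf (hx.1 i).1 (hy.1 i).1
  have h1 : ∀ i, (x ⊓ y) i ≤ x i := fun i => inf_le_left
  refine ⟨fun i => ⟨h0 i, (h1 i).trans (hx.1 i).2⟩, le_trans ?_ hx.2⟩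
  exact Finset.sum_le_sum fun i _ => abs_le_abs_of_nonneg (h0 i) (h1 i)

theorem simplexSupNorm_le {d : ℕ} {G : (Fin d → ℝ) → ℝ} {c : ℝ} (hc : 0 ≤ c)
    (h : ∀ x ∈ unitSimplex d, |G x| ≤ c) : simplexSupNorm G ≤ c :=
  Real.iSup_le (fun x => h x x.2) hc

theorem simplexSupNorm_nonneg {d : ℕ} (G : (Fin d → ℝ) → ℝ) : 0 ≤ simplexSupNorm G :=
  Real.iSup_nonneg fun _ => abs_nonneg _

/-! ### Approximation by Bernstein polynomials: continuous and smooth functions. -/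

theorem sq_norm_le_sum_sq {d : ℕ} (y : Fin d → ℝ) : ‖y‖ ^ 2 ≤ ∑ i, y i ^ 2 := by
  have h0 : 0 ≤ ∑ i, y i ^ 2 := Finset.sum_nonneg fun i _ => sq_nonneg _
  rw [← Real.le_sqrt (norm_nonneg _) h0, pi_norm_le_iff_of_nonneg (Real.sqrt_nonneg _)]
  intro i
  rw [Real.norm_eq_abs]
  exact Real.abs_le_sqrt (Finset.single_le_sum (f := fun i => y i ^ 2) (fun j _ => sq_nonneg _)
    (Finset.mem_univ i))

theorem sum_multinomialWeight_mul_sq_norm_le {d m : ℕ} (hm : 1 ≤ m) {x : Fin d → ℝ}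
    (hx : x ∈ unitSimplex d) :
    ∑ k ∈ latticeSimplex d m, ‖(fun i => (k i : ℝ) / m) - x‖ ^ 2 * multinomialWeight m k x
      ≤ 4 * d / m := by
  calc ∑ k ∈ latticeSimplex d m, ‖(fun i => (k i : ℝ) / m) - x‖ ^ 2 * multinomialWeight m k x
      ≤ ∑ k ∈ latticeSimplex d m, ∑ i, multinomialWeight m k x * ((k i : ℝ) / m - x i) ^ 2 := by
        refine Finset.sum_le_sum fun k _ => ?_
        rw [← Finset.mul_sum, mul_comm]
        exact mul_le_mul_of_nonneg_left (sq_norm_le_sum_sq _) (multinomialWeight_nonneg k hx)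
    _ ≤ ∑ _i : Fin d, (4 : ℝ) / m := by
        rw [Finset.sum_comm]
        exact Finset.sum_le_sum fun i _ => sum_multinomialWeight_mul_sq_le hm hx i
    _ = 4 * d / m := by
        simp
        ring

/-- Bernstein polynomials of a continuous function on the simplex converge uniformly. -/
theorem eventually_abs_bernsteinPoly_sub_le {d : ℕ} {G : (Fin d → ℝ) → ℝ}
    (hG : ContinuousOn G (unitSimplex d)) {ε : ℝ} (hε : 0 < ε) :
    ∀ᶠ m in atTop, ∀ x ∈ unitSimplex d, |bernsteinPoly m G x - G x| ≤ ε := by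
  have huc := (isCompact_unitSimplex d).uniformContinuousOn_of_continuous hG
  obtain ⟨δ, hδ, hδG⟩ := Metric.uniformContinuousOn_iff.1 huc (ε / 2) (half_pos hε)
  obtain ⟨M, hM⟩ := (isCompact_unitSimplex d).exists_bound_of_continuousOn hG
  have hM0 : 0 ≤ M := (norm_nonneg _).trans (hM 0 (zero_mem_unitSimplex d))
  have hlim : Tendsto (fun m : ℕ => (2 * M / δ ^ 2 * (4 * d)) / (m : ℝ)) atTop (𝓝 0) :=
    tendsto_const_div_atTop_nhds_zero_nat _
  filter_upwards [hlim.eventually (eventually_le_nhds (half_pos hε)), eventually_ge_atTop 1]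
    with m hm hm1 x hx
  rw [bernsteinPoly_sub_const m G _ hx]
  refine (abs_sum_mul_multinomialWeight_le hx _).trans ?_
  calc ∑ k ∈ latticeSimplex d m, |G (fun i => (k i : ℝ) / m) - G x| * multinomialWeight m k x
      ≤ ∑ k ∈ latticeSimplex d m, (ε / 2 * multinomialWeight m k x + 2 * M / δ ^ 2
          * (‖(fun i => (k i : ℝ) / m) - x‖ ^ 2 * multinomialWeight m k x)) := by
        refine Finset.sum_le_sum fun k hk => ?_
        have hkS := lattice_div_mem_unitSimplex hm1 hk
        rw [← mul_assoc, ← add_mul]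
        refine mul_le_mul_of_nonneg_right ?_ (multinomialWeight_nonneg k hx)
        by_cases hd : ‖(fun i => (k i : ℝ) / m) - x‖ < δ
        · have h1 := (hδG _ hkS _ hx (by rwa [dist_eq_norm])).le
          rw [Real.dist_eq] at h1
          have : 0 ≤ 2 * M / δ ^ 2 * ‖(fun i => (k i : ℝ) / m) - x‖ ^ 2 := by positivity
          linarith
        · have h1 : |G (fun i => (k i : ℝ) / m) - G x| ≤ 2 * M := by
            have h2 := hM _ hkS
            have h3 := hM _ hx
            rw [Real.norm_eq_abs] at h2 h3
            linarith [abs_sub (G fun i => (k i : ℝ) / m) (G x)]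
          -- Chebyshev: away from `x` the trivial bound is paid for by the second moment.
          have h4 : 2 * M ≤ 2 * M / δ ^ 2 * ‖(fun i => (k i : ℝ) / m) - x‖ ^ 2 := by
            rw [div_mul_eq_mul_div, le_div_iff₀ (by positivity)]
            have := not_lt.1 hd
            gcongr
          linarith
    _ = ε / 2 + 2 * M / δ ^ 2 * ∑ k ∈ latticeSimplex d m,
          ‖(fun i => (k i : ℝ) / m) - x‖ ^ 2 * multinomialWeight m k x := by
        rw [Finset.sum_add_distrib, ← Finset.mul_sum, ← Finset.mul_sum, sum_multinomialWeight m hx,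
          mul_one]
    _ ≤ ε / 2 + 2 * M / δ ^ 2 * (4 * d / m) := by
        gcongr
        exact sum_multinomialWeight_mul_sq_norm_le hm1 hx
    _ ≤ ε := by
        rw [← mul_div_assoc]
        linarith

/-- A function with Lipschitz partial derivatives satisfies a quadratic Taylor estimate. -/
theorem exists_taylor_bound {d : ℕ} {G : (Fin d → ℝ) → ℝ}
    (hG : DifferentiableOn ℝ G (unitSimplex d))
    (hL : ∀ i : Fin d, ∃ L : NNReal, LipschitzOnWith L
      (fun x => fderivWithin ℝ G (unitSimplex d) x (Pi.single i 1)) (unitSimplex d)) :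
    ∃ K : ℝ, 0 ≤ K ∧
      (∀ x ∈ unitSimplex d, ∀ y ∈ unitSimplex d,
        ‖fderivWithin ℝ G (unitSimplex d) y - fderivWithin ℝ G (unitSimplex d) x‖
          ≤ K * ‖y - x‖) ∧
      ∀ x ∈ unitSimplex d, ∀ y ∈ unitSimplex d,
        |G y - G x - fderivWithin ℝ G (unitSimplex d) x (y - x)| ≤ K * ‖y - x‖ ^ 2 := by
  choose L hL using hL
  set S := unitSimplex d
  set D := fderivWithin ℝ G S
  set K : ℝ := ∑ i, (L i : ℝ) with hK
  have hK0 : 0 ≤ K := Finset.sum_nonneg fun i _ => (L i).2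
  have hD : ∀ x ∈ S, ∀ y ∈ S, ‖D y - D x‖ ≤ K * ‖y - x‖ := by
    intro x hx y hy
    -- For the sup norm on `ℝ^d`, the operator norm is bounded by the sum of the absolute values of
    -- the partial derivatives.
    refine ContinuousLinearMap.opNorm_le_bound _ (by positivity) fun v => ?_
    have hv : (D y - D x) v = ∑ i, v i * (D y (Pi.single i 1) - D x (Pi.single i 1)) := by
      conv_lhs => rw [pi_eq_sum_univ' v]
      simp [map_sum]
    rw [hv, hK, Finset.sum_mul, Finset.sum_mul]
    refine norm_sum_le_of_le _ fun i _ => ?_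
    rw [norm_mul, mul_comm]
    refine mul_le_mul ?_ (norm_le_pi_norm v i) (norm_nonneg _) (by positivity)
    have := (hL i).dist_le_mul y hy x hx
    rwa [dist_eq_norm, dist_eq_norm] at this
  refine ⟨K, hK0, hD, fun x hx y hy => ?_⟩
  have hseg : segment ℝ x y ⊆ S := (convex_unitSimplex d).segment_subset hx hy
  -- Working on the segment keeps the derivative within `K ‖y - x‖` of `D x`, which supplies the
  -- second factor `‖y - x‖`.
  have h := Convex.norm_image_sub_le_of_norm_hasFDerivWithin_le' (f := G) (f' := D)
    (s := segment ℝ x y) (φ := D x) (C := K * ‖y - x‖)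
    (fun z hz => ((hG z (hseg hz)).hasFDerivWithinAt).mono hseg)
    (fun z hz => (hD x hx z (hseg hz)).trans
      (mul_le_mul_of_nonneg_left (norm_sub_le_of_mem_segment hz) hK0))
    (convex_segment x y) (left_mem_segment ℝ x y) (right_mem_segment ℝ x y)
  rw [Real.norm_eq_abs] at h
  linarith [h, sq ‖y - x‖, mul_assoc K ‖y - x‖ ‖y - x‖]

/-- The derivative is Lipschitz and the simplex lies in the unit ball, so the derivative is bounded
by its norm at `0` plus `K`. -/
theorem exists_lipschitz_bound {d : ℕ} {G : (Fin d → ℝ) → ℝ}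
    (hG : DifferentiableOn ℝ G (unitSimplex d))
    (hL : ∀ i : Fin d, ∃ L : NNReal, LipschitzOnWith L
      (fun x => fderivWithin ℝ G (unitSimplex d) x (Pi.single i 1)) (unitSimplex d)) :
    ∃ K : ℝ, 0 ≤ K ∧ ∀ x ∈ unitSimplex d, ∀ y ∈ unitSimplex d, |G y - G x| ≤ K * ‖y - x‖ := by
  obtain ⟨K, hK0, hD, -⟩ := exists_taylor_bound hG hL
  have h0 := zero_mem_unitSimplex d
  refine ⟨K + ‖fderivWithin ℝ G (unitSimplex d) 0‖, by positivity, fun x hx y hy => ?_⟩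
  refine (convex_unitSimplex d).norm_image_sub_le_of_norm_fderivWithin_le hG (fun z hz => ?_) hx hy
  have h1 := hD 0 h0 z hz
  have h2 : ‖z - 0‖ ≤ 1 := by
    rw [sub_zero, pi_norm_le_iff_of_nonneg zero_le_one]
    intro i
    rw [Real.norm_eq_abs, abs_of_nonneg (hz.1 i).1]
    exact (hz.1 i).2
  have h3 := norm_sub_norm_le (fderivWithin ℝ G (unitSimplex d) z)
    (fderivWithin ℝ G (unitSimplex d) 0)
  nlinarith [mul_le_mul_of_nonneg_left h2 hK0]

/-- Bernstein polynomials of a function with Lipschitz partial derivatives converge at rate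
`1 / m`. -/
theorem exists_abs_bernsteinPoly_sub_le {d : ℕ} {G : (Fin d → ℝ) → ℝ}
    (hG : DifferentiableOn ℝ G (unitSimplex d))
    (hL : ∀ i : Fin d, ∃ L : NNReal, LipschitzOnWith L
      (fun x => fderivWithin ℝ G (unitSimplex d) x (Pi.single i 1)) (unitSimplex d)) :
    ∃ K : ℝ, 0 ≤ K ∧ ∀ m : ℕ, 1 ≤ m → ∀ x ∈ unitSimplex d,
      |bernsteinPoly m G x - G x| ≤ K * (m : ℝ)⁻¹ := by
  obtain ⟨K, hK0, -, hT⟩ := exists_taylor_bound hG hL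
  refine ⟨K * (4 * d), by positivity, fun m hm x hx => ?_⟩
  have hm0 : (m : ℝ) ≠ 0 := by positivity
  set D := fderivWithin ℝ G (unitSimplex d) x
  -- The weights have mean `x`, so the first-order Taylor term vanishes; this improves `m^{-1/2}` to
  -- `m^{-1}`.
  have hlin : ∑ k ∈ latticeSimplex d m,
      D ((fun i => (k i : ℝ) / m) - x) * multinomialWeight m k x = 0 := by
    have hz : ∑ k ∈ latticeSimplex d m,
        multinomialWeight m k x • ((fun i => (k i : ℝ) / m) - x) = 0 := by
      ext i
      rw [Finset.sum_apply]
      have h1 := sum_multinomialWeight_mul_coord m hx i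
      have h2 := sum_multinomialWeight m hx
      calc ∑ k ∈ latticeSimplex d m, multinomialWeight m k x * ((k i : ℝ) / m - x i)
          = (∑ k ∈ latticeSimplex d m, multinomialWeight m k x * (k i : ℝ)) / m
            - (∑ k ∈ latticeSimplex d m, multinomialWeight m k x) * x i := by
            rw [Finset.sum_div, Finset.sum_mul, ← Finset.sum_sub_distrib]
            refine Finset.sum_congr rfl fun k _ => ?_
            ring
        _ = 0 := by
            rw [h1, h2]
            field_simp
            ring
    calc ∑ k ∈ latticeSimplex d m, D ((fun i => (k i : ℝ) / m) - x) * multinomialWeight m k x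
        = D (∑ k ∈ latticeSimplex d m,
          multinomialWeight m k x • ((fun i => (k i : ℝ) / m) - x)) := by
          rw [map_sum]
          refine Finset.sum_congr rfl fun k _ => ?_
          rw [map_smul, smul_eq_mul, mul_comm]
      _ = 0 := by rw [hz, map_zero]
  have hsplit : bernsteinPoly m G x - G x = ∑ k ∈ latticeSimplex d m,
      (G (fun i => (k i : ℝ) / m) - G x - D ((fun i => (k i : ℝ) / m) - x))
        * multinomialWeight m k x := by
    rw [bernsteinPoly_sub_const m G _ hx, ← sub_zero (Finset.sum _ _), ← hlin,
      ← Finset.sum_sub_distrib]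
    simp only [sub_mul]
  rw [hsplit]
  refine (abs_sum_mul_multinomialWeight_le hx _).trans ?_
  calc ∑ k ∈ latticeSimplex d m,
      |G (fun i => (k i : ℝ) / m) - G x - D ((fun i => (k i : ℝ) / m) - x)|
        * multinomialWeight m k x
      ≤ ∑ k ∈ latticeSimplex d m,
        K * (‖(fun i => (k i : ℝ) / m) - x‖ ^ 2 * multinomialWeight m k x) := by
        refine Finset.sum_le_sum fun k hk => ?_
        rw [← mul_assoc]
        exact mul_le_mul_of_nonneg_right (hT x hx _ (lattice_div_mem_unitSimplex hm hk))
          (multinomialWeight_nonneg k hx)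
    _ ≤ K * (4 * d / m) := by
        rw [← Finset.mul_sum]
        exact mul_le_mul_of_nonneg_left (sum_multinomialWeight_mul_sq_norm_le hm hx) hK0
    _ = K * (4 * d) * (m : ℝ)⁻¹ := by ring

/-! ### Orthant increments, the error decomposition and consistency. -/

/-- The orthants `Iic x`, `Iic y` differ by a set of mass of order `‖y - x‖` if the c.d.f. is
Lipschitz on the simplex. -/
theorem measureReal_symmDiff_Iic_le {d : ℕ} {μ : Measure (Fin d → ℝ)} [IsProbabilityMeasure μ]
    {K : ℝ} (hK0 : 0 ≤ K)
    (hK : ∀ x ∈ unitSimplex d, ∀ y ∈ unitSimplex d, |jointCDF μ y - jointCDF μ x| ≤ K * ‖y - x‖)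
    {x y : Fin d → ℝ} (hx : x ∈ unitSimplex d) (hy : y ∈ unitSimplex d) :
    μ.real (symmDiff (Set.Iic x) (Set.Iic y)) ≤ 2 * K * ‖y - x‖ := by
  have hone : ∀ u ∈ unitSimplex d, ∀ v ∈ unitSimplex d,
      μ.real (Set.Iic u \ Set.Iic v) ≤ K * ‖u - v‖ := by
    intro u hu v hv
    have hw := inf_mem_unitSimplex hu hv
    have h1 : Set.Iic u \ Set.Iic v = Set.Iic u \ Set.Iic (u ⊓ v) := by
      -- Replacing `v` by `u ⊓ v` makes the orthants nested, so the mass becomes a difference of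
      -- c.d.f. values.
      rw [← Set.Iic_inter_Iic, Set.sdiff_self_inter]
    rw [h1, measureReal_sdiff (Set.Iic_subset_Iic.2 inf_le_left) measurableSet_Iic]
    have h2 := (le_abs_self _).trans (hK _ hw _ hu)
    refine h2.trans (mul_le_mul_of_nonneg_left ?_ hK0)
    refine (pi_norm_le_iff_of_nonneg (norm_nonneg _)).2 fun i => ?_
    refine le_trans ?_ (norm_le_pi_norm (u - v) i)
    simp only [Pi.sub_apply, Pi.inf_apply, Real.norm_eq_abs]
    rcases le_total (u i) (v i) with h | h
    · simp [inf_eq_left.2 h]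
    · rw [inf_eq_right.2 h]
  rw [Set.symmDiff_def]
  refine (measureReal_union_le _ _).trans ?_
  have h1 := hone x hx y hy
  have h2 := hone y hy x hx
  rw [norm_sub_rev] at h1
  linarith

theorem bernsteinPoly_add {d : ℕ} (m : ℕ) (G H : (Fin d → ℝ) → ℝ) (x : Fin d → ℝ) :
    bernsteinPoly m (fun y => G y + H y) x = bernsteinPoly m G x + bernsteinPoly m H x := by
  simp only [bernsteinPoly, add_mul, Finset.sum_add_distrib]

theorem abs_bernsteinPoly_le {d m : ℕ} {G : (Fin d → ℝ) → ℝ} {c : ℝ} (hc : ∀ y, |G y| ≤ c)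
    {x : Fin d → ℝ} (hx : x ∈ unitSimplex d) : |bernsteinPoly m G x| ≤ c := by
  refine (abs_sum_mul_multinomialWeight_le hx _).trans ?_
  calc ∑ k ∈ latticeSimplex d m, |G fun i => (k i : ℝ) / m| * multinomialWeight m k x
      ≤ ∑ k ∈ latticeSimplex d m, c * multinomialWeight m k x :=
        Finset.sum_le_sum fun k _ =>
          mul_le_mul_of_nonneg_right (hc _) (multinomialWeight_nonneg k hx)
    _ = c := by rw [← Finset.mul_sum, sum_multinomialWeight m hx, mul_one]

theorem bernsteinEstimator_eq {d : ℕ} {Ω : Type u} (X : ℕ → Ω → Fin d → ℝ) (n m : ℕ) (ω : Ω)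
    (F : (Fin d → ℝ) → ℝ) (x : Fin d → ℝ) :
    bernsteinEstimator X n m ω x
      = bernsteinPoly m (fun y => empiricalCDF X n ω y - F y) x + bernsteinPoly m F x := by
  rw [← bernsteinPoly_add]
  simp only [sub_add_cancel, bernsteinEstimator]

/-- Uniform strong consistency of the Bernstein estimator. -/
theorem IsIIDSample.tendsto_simplexSupNorm_bernsteinEstimator_sub {d : ℕ} {Ω : Type u}
    [MeasurableSpace Ω] {P : Measure Ω} [IsProbabilityMeasure P] {μ : Measure (Fin d → ℝ)}
    [IsProbabilityMeasure μ] {X : ℕ → Ω → Fin d → ℝ} (hX : IsIIDSample P μ X)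
    (hF : ContinuousOn (jointCDF μ) (unitSimplex d)) :
    ∀ᵐ ω ∂P, Tendsto
      (fun p : ℕ × ℕ => simplexSupNorm fun x => bernsteinEstimator X p.1 p.2 ω x - jointCDF μ x)
      (atTop ×ˢ atTop) (𝓝 0) := by
  filter_upwards [hX.glivenko_cantelli] with ω hω
  refine Metric.tendsto_nhds.2 fun ε hε => ?_
  have hε4 : 0 < ε / 4 := by positivity
  filter_upwards [(hω _ hε4).prod_mk (eventually_abs_bernsteinPoly_sub_le hF hε4)] with p hp
  rw [Real.dist_eq, sub_zero, abs_of_nonneg (simplexSupNorm_nonneg _)]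
  refine (simplexSupNorm_le (c := ε / 2) (by positivity) fun x hx => ?_).trans_lt (half_lt_self hε)
  rw [bernsteinEstimator_eq X p.1 p.2 ω (jointCDF μ), add_sub_assoc]
  refine (abs_add_le _ _).trans ?_
  have h1 := abs_bernsteinPoly_le (m := p.2) hp.1 hx
  have h2 := hp.2 x hx
  linarith

theorem empiricalCDF_mem_Icc {d : ℕ} {Ω : Type u} (X : ℕ → Ω → Fin d → ℝ) (n : ℕ) (ω : Ω)
    (x : Fin d → ℝ) : empiricalCDF X n ω x ∈ Set.Icc (0 : ℝ) 1 := by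
  have h0 : ∀ y, 0 ≤ (Set.Iic x).indicator (fun _ => (1 : ℝ)) y :=
    fun y => Set.indicator_nonneg (fun _ _ => zero_le_one) y
  have h1 : ∀ y, (Set.Iic x).indicator (fun _ => (1 : ℝ)) y ≤ 1 :=
    fun y => Set.indicator_le_self' (fun _ _ => zero_le_one) y
  refine ⟨mul_nonneg (by positivity) (Finset.sum_nonneg fun i _ => h0 _), ?_⟩
  refine (mul_le_mul_of_nonneg_left (Finset.sum_le_sum fun i _ => h1 (X i ω))
    (by positivity : (0 : ℝ) ≤ (n : ℝ)⁻¹)).trans ?_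
  simp only [Finset.sum_const, Finset.card_range, nsmul_eq_mul, mul_one]
  exact inv_mul_le_one

theorem abs_empiricalCDF_sub_jointCDF_le {d : ℕ} {Ω : Type u} (X : ℕ → Ω → Fin d → ℝ) (n : ℕ)
    (ω : Ω) (μ : Measure (Fin d → ℝ)) [IsProbabilityMeasure μ] (x : Fin d → ℝ) :
    |empiricalCDF X n ω x - jointCDF μ x| ≤ 1 := by
  have h1 := empiricalCDF_mem_Icc X n ω x
  have h2 : 0 ≤ jointCDF μ x := measureReal_nonneg
  have h3 : jointCDF μ x ≤ 1 := measureReal_le_one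
  rw [abs_le]
  constructor <;> linarith [h1.1, h1.2]

/-! ### Local oscillation of the empirical process. -/

/-- A bounded function whose increments over distances `≤ 2 a` are at most `s` is approximated
by its Bernstein polynomial up to `s` and an exponentially small term. -/
theorem abs_bernsteinPoly_sub_le_of_modulus {d m : ℕ} (hm : 1 ≤ m) {H : (Fin d → ℝ) → ℝ}
    (hH : ∀ y, |H y| ≤ 1) {a s : ℝ} (ha0 : 0 ≤ a) (ha1 : a ≤ 1) (hs : 0 ≤ s)
    {x : Fin d → ℝ} (hx : x ∈ unitSimplex d)
    (hmod : ∀ y ∈ unitSimplex d, ‖y - x‖ ≤ 2 * a → |H y - H x| ≤ s) :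
    |bernsteinPoly m H x - H x| ≤ s + 4 * d * Real.exp (-(m * a ^ 2)) := by
  have hm0 : (0 : ℝ) < m := by exact_mod_cast hm
  have hw := fun k => multinomialWeight_nonneg (m := m) k hx
  set T : Fin d → Finset (Fin d → ℕ) := fun i =>
    (latticeSimplex d m).filter fun k => 2 * a * m < |(k i : ℝ) - m * x i| with hT
  rw [bernsteinPoly_sub_const m H _ hx]
  refine (abs_sum_mul_multinomialWeight_le hx _).trans ?_
  calc ∑ k ∈ latticeSimplex d m, |H (fun i => (k i : ℝ) / m) - H x| * multinomialWeight m k x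
      ≤ ∑ k ∈ latticeSimplex d m, (s * multinomialWeight m k x
          + 2 * ∑ i, if 2 * a * m < |(k i : ℝ) - m * x i| then multinomialWeight m k x else 0) := by
        refine Finset.sum_le_sum fun k hk => ?_
        have hnn : ∀ i ∈ Finset.univ, (0 : ℝ) ≤
            if 2 * a * m < |(k i : ℝ) - m * x i| then multinomialWeight m k x else 0 := by
          intro i _
          split_ifs
          exacts [hw k, le_rfl]
        by_cases hd : ‖(fun i => (k i : ℝ) / m) - x‖ ≤ 2 * a
        · have h1 := mul_le_mul_of_nonneg_right
            (hmod _ (lattice_div_mem_unitSimplex hm hk) hd) (hw k)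
          linarith [Finset.sum_nonneg hnn]
        · have h2 : ∃ i, 2 * a * m < |(k i : ℝ) - m * x i| := by
            by_contra hcon
            push Not at hcon
            refine hd ((pi_norm_le_iff_of_nonneg (by positivity)).2 fun i => ?_)
            have h3 : ((k i : ℝ) / m - x i) = (k i - m * x i) / m := by field_simp
            rw [Pi.sub_apply, h3, Real.norm_eq_abs, abs_div, abs_of_pos hm0, div_le_iff₀ hm0]
            exact hcon i
          obtain ⟨i, hi⟩ := h2
          have h3 := Finset.single_le_sum hnn (Finset.mem_univ i)
          rw [if_pos hi] at h3
          have h4 : |H (fun i => (k i : ℝ) / m) - H x| ≤ 2 := by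
            linarith [abs_sub (H fun i => (k i : ℝ) / m) (H x), hH (fun i => (k i : ℝ) / m), hH x]
          have h5 := mul_le_mul_of_nonneg_right h4 (hw k)
          have h6 := mul_nonneg hs (hw k)
          linarith
    _ = s + 2 * ∑ i, ∑ k ∈ T i, multinomialWeight m k x := by
        rw [Finset.sum_add_distrib, ← Finset.mul_sum, ← Finset.mul_sum, sum_multinomialWeight m hx,
          Finset.sum_comm, mul_one]
        simp only [hT, Finset.sum_filter]
    _ ≤ s + 2 * ∑ _i : Fin d, 2 * Real.exp (-(m * a ^ 2)) := by
        gcongr with i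
        exact sum_multinomialWeight_filter_le hx i ha0 ha1
    _ = s + 4 * d * Real.exp (-(m * a ^ 2)) := by
        simp
        ring

/-- Deviations of the increments of the empirical process over brackets control all increments. -/
theorem abs_increment_le_of_brackets {d N n : ℕ} {Ω : Type u} {X : ℕ → Ω → Fin d → ℝ} {ω : Ω}
    {μ : Measure (Fin d → ℝ)} [IsProbabilityMeasure μ] {J : Type*}
    {A B : J → Set (Fin d → ℝ)} (hA : ∀ j, MeasurableSet (A j))
    (hAB : ∀ x, ∃ j, A j ⊆ Set.Iic x ∧ Set.Iic x ⊆ B j ∧ μ.real (B j \ A j) ≤ d / N)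
    {δ s : ℝ}
    (hdev : ∀ j j', μ.real (symmDiff (A j) (B j')) ≤ δ + 2 * d / N →
      (empiricalFreq X n ω (B j') - empiricalFreq X n ω (A j)) - (μ.real (B j') - μ.real (A j))
        ≤ s)
    {x y : Fin d → ℝ} (hxy : μ.real (symmDiff (Set.Iic x) (Set.Iic y)) ≤ δ) :
    |(empiricalCDF X n ω y - jointCDF μ y) - (empiricalCDF X n ω x - jointCDF μ x)|
      ≤ s + 2 * d / N := by
  have hN2 : 2 * (d : ℝ) / N = d / N + d / N := by ring
  have key : ∀ x y : Fin d → ℝ, μ.real (symmDiff (Set.Iic x) (Set.Iic y)) ≤ δ →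
      (empiricalCDF X n ω y - jointCDF μ y) - (empiricalCDF X n ω x - jointCDF μ x)
        ≤ s + 2 * d / N := by
    intro x y hxy
    obtain ⟨j, hjA, hjB, hj⟩ := hAB x
    obtain ⟨j', hjA', hjB', hj'⟩ := hAB y
    -- An inner bracket of `x` is paired with an outer bracket of `y`: by monotonicity this bounds
    -- the increment from above, and exchanging `x` and `y` bounds it from below.
    have hsub : symmDiff (A j) (B j') ⊆
        (B j \ A j) ∪ (symmDiff (Set.Iic x) (Set.Iic y) ∪ (B j' \ A j')) := by
      intro z hz
      have a1 := @hjA z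
      have a2 := @hjB z
      have a3 := @hjA' z
      have a4 := @hjB' z
      simp only [Set.mem_symmDiff, Set.mem_union, Set.mem_sdiff] at hz ⊢
      tauto
    have hmeas : μ.real (symmDiff (A j) (B j')) ≤ δ + 2 * d / N := by
      refine (measureReal_mono hsub).trans ((measureReal_union_le _ _).trans ?_)
      have := measureReal_union_le (μ := μ) (symmDiff (Set.Iic x) (Set.Iic y)) (B j' \ A j')
      linarith
    have h := hdev j j' hmeas
    rw [measureReal_sdiff (hjA.trans hjB) (hA j)] at hj
    rw [measureReal_sdiff (hjA'.trans hjB') (hA j')] at hj'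
    have e1 := empiricalFreq_mono X n ω hjA
    have e2 := empiricalFreq_mono X n ω hjB'
    have m1 : μ.real (Set.Iic x) ≤ μ.real (B j) := measureReal_mono hjB
    have m2 : μ.real (A j') ≤ μ.real (Set.Iic y) := measureReal_mono hjA'
    simp only [empiricalCDF_eq_empiricalFreq, jointCDF]
    linarith
  have h1 := key x y hxy
  have h2 := key y x (by rwa [symmDiff_comm])
  rw [abs_le]
  constructor <;> linarith

/-! ### The rates `α_n` and `β_{n,m}`. -/

theorem alphaRate_nonneg (n : ℕ) : 0 ≤ alphaRate n := Real.sqrt_nonneg _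

theorem betaRate_nonneg (n m : ℕ) : 0 ≤ betaRate n m :=
  mul_nonneg (alphaRate_nonneg n) (Real.sqrt_nonneg _)

theorem alphaRate_sq (n : ℕ) : alphaRate n ^ 2 = Real.log n / n := by
  have : 0 ≤ (n : ℝ)⁻¹ * Real.log n :=
    mul_nonneg (by positivity) (Real.log_natCast_nonneg n)
  rw [alphaRate, Real.sq_sqrt this, inv_mul_eq_div]

theorem betaRate_sq (n m : ℕ) : betaRate n m ^ 2 = alphaRate n ^ 2 * alphaRate m := by
  rw [betaRate, mul_pow, Real.sq_sqrt (alphaRate_nonneg m)]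

theorem betaRate_pow_four (n m : ℕ) :
    betaRate n m ^ 4 = (Real.log n / n) ^ 2 * (Real.log m / m) := by
  rw [show betaRate n m ^ 4 = (betaRate n m ^ 2) ^ 2 by ring, betaRate_sq, mul_pow, alphaRate_sq,
    alphaRate_sq]

theorem alphaRate_pos {m : ℕ} (hm : 2 ≤ m) : 0 < alphaRate m := by
  have h1 : (1 : ℝ) < m := by exact_mod_cast hm
  exact Real.sqrt_pos.2 (mul_pos (by positivity) (Real.log_pos h1))

theorem alphaRate_le_one (m : ℕ) : alphaRate m ≤ 1 := by
  refine (sq_le_one_iff₀ (alphaRate_nonneg m)).1 ?_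
  rw [alphaRate_sq]
  exact div_le_one_of_le₀ (Real.log_le_self (Nat.cast_nonneg m)) (Nat.cast_nonneg m)

/-- This is why `α_m` is the right localization radius: the Chernoff tail there has the order of the
bias. -/
theorem exp_neg_mul_alphaRate_sq {m : ℕ} (hm : 1 ≤ m) :
    Real.exp (-(m * alphaRate m ^ 2)) = (m : ℝ)⁻¹ := by
  have hm0 : (0 : ℝ) < m := by exact_mod_cast hm
  rw [alphaRate_sq, mul_div_cancel₀ _ hm0.ne', Real.exp_neg, Real.exp_log hm0]

theorem log_le_two_mul_sqrt {x : ℝ} (hx : 0 < x) : Real.log x ≤ 2 * Real.sqrt x := by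
  have h1 := Real.log_le_sub_one_of_pos (Real.sqrt_pos.2 hx)
  rw [Real.log_sqrt hx.le] at h1
  linarith

/-- Squaring twice gives `(log n / n)² ≤ log m / m ≤ 2 / √m`. As `log n ≥ 1` this yields `m ≤ 4 n⁴ ≤
n⁶`, so polynomially many orders enter the union bound. -/
theorem le_pow_six_of_betaRate_le_alphaRate {n m : ℕ} (hn : 3 ≤ n) (hm : 2 ≤ m)
    (h : betaRate n m ≤ alphaRate m) : m ≤ n ^ 6 := by
  have hn0 : (3 : ℝ) ≤ n := by exact_mod_cast hn
  have hm0 : (0 : ℝ) < m := by positivity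
  have hlogn : 1 ≤ Real.log n := by
    rw [Real.le_log_iff_exp_le (by positivity)]
    linarith [Real.exp_one_lt_d9]
  have ha := alphaRate_pos hm
  have h1 : alphaRate n ^ 2 ≤ alphaRate m := by
    have h2 : betaRate n m ^ 2 ≤ alphaRate m ^ 2 := pow_le_pow_left₀ (betaRate_nonneg n m) h 2
    rw [betaRate_sq, sq (alphaRate m)] at h2
    exact le_of_mul_le_mul_right h2 ha
  have h3 : (Real.log n / n) ^ 2 ≤ Real.log m / m := by
    rw [← alphaRate_sq, ← alphaRate_sq]
    exact pow_le_pow_left₀ (sq_nonneg _) h1 2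
  have h4 : (1 / (n : ℝ)) ^ 2 ≤ (Real.log n / n) ^ 2 := by gcongr
  have h5 : (1 / (n : ℝ)) ^ 2 ≤ 2 * Real.sqrt m / m :=
    (h4.trans h3).trans (by gcongr; exact log_le_two_mul_sqrt hm0)
  have hs : 0 < Real.sqrt m := Real.sqrt_pos.2 hm0
  have hss : Real.sqrt m * Real.sqrt m = m := Real.mul_self_sqrt hm0.le
  have h6 : Real.sqrt m ≤ 2 * (n : ℝ) ^ 2 := by
    rw [div_pow, one_pow, div_le_div_iff₀ (by positivity) hm0] at h5
    refine le_of_mul_le_mul_right ?_ hs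
    nlinarith
  have h7 : (m : ℝ) ≤ (n : ℝ) ^ 6 := by
    calc (m : ℝ) = Real.sqrt m * Real.sqrt m := hss.symm
      _ ≤ (2 * (n : ℝ) ^ 2) * (2 * (n : ℝ) ^ 2) := by gcongr
      _ = 4 * (n : ℝ) ^ 4 := by ring
      _ ≤ (n : ℝ) ^ 2 * (n : ℝ) ^ 4 := by
        gcongr
        nlinarith
      _ = (n : ℝ) ^ 6 := by ring
  exact_mod_cast h7

theorem betaRate_self {n : ℕ} (hn : 2 ≤ n) :
    betaRate n n = (n : ℝ) ^ (-(3 / 4) : ℝ) * Real.log n ^ (3 / 4 : ℝ) := by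
  have h1 : (1 : ℝ) < n := by exact_mod_cast hn
  have h0 : (0 : ℝ) < n := by positivity
  have hl := Real.log_pos h1
  -- Fourth powers clear the nested square roots.
  refine (pow_left_inj₀ (betaRate_nonneg n n) (by positivity) (n := 4) (by norm_num)).1 ?_
  rw [betaRate_pow_four, mul_pow, ← Real.rpow_mul_natCast h0.le, ← Real.rpow_mul_natCast hl.le]
  have e1 : (-(3 / 4) : ℝ) * ((4 : ℕ) : ℝ) = -((3 : ℕ) : ℝ) := by norm_num
  have e2 : (3 / 4 : ℝ) * ((4 : ℕ) : ℝ) = ((3 : ℕ) : ℝ) := by norm_num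
  rw [e1, e2, Real.rpow_neg h0.le, Real.rpow_natCast, Real.rpow_natCast]
  field_simp

theorem betaRate_le_alphaRate_of_sq_le {n m : ℕ}
    (h : (Real.log n / n) ^ 2 ≤ Real.log m / m) : betaRate n m ≤ alphaRate m := by
  have h1 : alphaRate n ^ 2 ≤ alphaRate m := by
    refine (pow_le_pow_iff_left₀ (sq_nonneg _) (alphaRate_nonneg m) two_ne_zero).1 ?_
    rwa [alphaRate_sq, alphaRate_sq]
  refine (pow_le_pow_iff_left₀ (betaRate_nonneg n m) (alphaRate_nonneg m) two_ne_zero).1 ?_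
  rw [betaRate_sq, sq (alphaRate m)]
  exact mul_le_mul_of_nonneg_right h1 (alphaRate_nonneg m)

theorem inv_le_betaRate_of_le {n m : ℕ} (hm : 1 ≤ m)
    (h : (n : ℝ) ^ 2 ≤ (m : ℝ) ^ 3 * Real.log n ^ 2 * Real.log m) (hn : 1 ≤ n) :
    (m : ℝ)⁻¹ ≤ betaRate n m := by
  have hm0 : (0 : ℝ) < m := by exact_mod_cast hm
  have hn0 : (0 : ℝ) < n := by exact_mod_cast hn
  refine (pow_le_pow_iff_left₀ (by positivity) (betaRate_nonneg n m) four_ne_zero).1 ?_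
  rw [betaRate_pow_four, inv_pow, div_pow, div_mul_div_comm, ← one_div,
    div_le_div_iff₀ (by positivity) (by positivity)]
  nlinarith [mul_le_mul_of_nonneg_right h hm0.le]

theorem inv_le_betaRate_self {n : ℕ} (hn : 3 ≤ n) : (n : ℝ)⁻¹ ≤ betaRate n n := by
  have hn0 : (3 : ℝ) ≤ n := by exact_mod_cast hn
  have hlogn : 1 ≤ Real.log n := by
    rw [Real.le_log_iff_exp_le (by positivity)]
    linarith [Real.exp_one_lt_d9]
  refine inv_le_betaRate_of_le (by omega) ?_ (by omega)
  calc (n : ℝ) ^ 2 ≤ (n : ℝ) ^ 3 := pow_le_pow_right₀ (by linarith) (by norm_num)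
    _ = (n : ℝ) ^ 3 * 1 ^ 2 * 1 := by ring
    _ ≤ (n : ℝ) ^ 3 * Real.log n ^ 2 * Real.log n := by gcongr

theorem betaRate_self_le_alphaRate {n : ℕ} : betaRate n n ≤ alphaRate n := by
  refine betaRate_le_alphaRate_of_sq_le ?_
  have h := alphaRate_le_one n
  have h2 : alphaRate n ^ 2 ≤ 1 := pow_le_one₀ (alphaRate_nonneg n) h
  rw [alphaRate_sq] at h2
  have h3 : 0 ≤ Real.log n / n := div_nonneg (Real.log_natCast_nonneg n) (Nat.cast_nonneg n)
  nlinarith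

/-- From `log √x ≤ √x / e` one gets `(log x)² ≤ (4 / e²) x`, and `4 / e² < log 2`. The constant `log
2` is the least value of `log m` for `m ≥ 2`. -/
theorem log_sq_le_mul_log_two {x : ℝ} (hx : 1 ≤ x) : Real.log x ^ 2 ≤ x * Real.log 2 := by
  have hx0 : 0 < x := by linarith
  have hs : 0 < Real.sqrt x := Real.sqrt_pos.2 hx0
  have he := Real.exp_pos 1
  have h1 := Real.log_le_sub_one_of_pos (div_pos hs he)
  rw [Real.log_div hs.ne' he.ne', Real.log_exp, Real.log_sqrt hx0.le] at h1
  have h2 : Real.log x ≤ 2 * (Real.sqrt x / Real.exp 1) := by linarith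
  have h3 : Real.sqrt x / Real.exp 1 ≤ Real.sqrt x / (27 / 10) := by
    gcongr
    linarith [Real.exp_one_gt_d9]
  have h4 : Real.log x ≤ Real.sqrt x * (2 / (27 / 10)) := by linarith
  have h5 : Real.log x ^ 2 ≤ (Real.sqrt x * (2 / (27 / 10))) ^ 2 :=
    pow_le_pow_left₀ (Real.log_nonneg hx) h4 2
  rw [mul_pow, Real.sq_sqrt hx0.le] at h5
  nlinarith [Real.log_two_gt_d9]

/-- A range of orders `m` satisfying the growth conditions on `betaRate n m`. -/
theorem rate_conditions_of_range {n m : ℕ} (hn : 2 ≤ n)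
    (h1 : 2 * (n : ℝ) ^ (2 / 3 : ℝ) / Real.log n ≤ (m : ℝ))
    (h2 : (m : ℝ) ≤ (n : ℝ) ^ 2 / Real.log n) :
    2 ≤ m ∧ (m : ℝ)⁻¹ ≤ betaRate n m ∧ betaRate n m ≤ alphaRate m := by
  have hn1 : (1 : ℝ) < n := by exact_mod_cast hn
  have hn0 : (0 : ℝ) < n := by linarith
  have hl := Real.log_pos hn1
  -- The cube root turns the fractional powers into polynomials in `c`.
  set c : ℝ := (n : ℝ) ^ (1 / 3 : ℝ) with hc
  have hc0 : 0 < c := Real.rpow_pos_of_pos hn0 _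
  have hc3 : c ^ 3 = n := by
    rw [hc, ← Real.rpow_mul_natCast hn0.le]
    norm_num
  have hc2 : (n : ℝ) ^ (2 / 3 : ℝ) = c ^ 2 := by
    rw [hc, ← Real.rpow_mul_natCast hn0.le]
    norm_num
  have hc1 : 1 < c := by
    by_contra hle
    have := pow_le_one₀ hc0.le (not_lt.1 hle) (n := 3)
    linarith
  have hlog : Real.log n = 3 * Real.log c := by
    rw [← hc3, Real.log_pow]
    norm_num
  have hlc : Real.log c ≤ c - 1 := Real.log_le_sub_one_of_pos hc0
  have hlc0 : 0 < Real.log c := Real.log_pos hc1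
  rw [hc2, div_le_iff₀ hl] at h1
  rw [le_div_iff₀ hl] at h2
  have hlc2 : 2 * Real.log c ≤ c ^ 2 - 1 := by
    have := Real.log_le_sub_one_of_pos (pow_pos hc0 2)
    rw [Real.log_pow] at this
    exact_mod_cast this
  -- If `m ≤ 1`, then `2 c² ≤ log n = 3 log c ≤ (3/2) (c² - 1)`, which is absurd.
  have hm2 : 2 ≤ m := by
    have : (1 : ℝ) < m := by
      by_contra hle
      have := mul_le_mul_of_nonneg_right (not_lt.1 hle) hl.le
      nlinarith
    exact_mod_cast this
  have hm0 : (2 : ℝ) ≤ m := by exact_mod_cast hm2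
  have hlm : 0 < Real.log m := Real.log_pos (by linarith)
  refine ⟨hm2, inv_le_betaRate_of_le (by omega) ?_ (by omega), betaRate_le_alphaRate_of_sq_le ?_⟩
  · have hcm : 2 * c ≤ 3 * m := by
      have h3 : (m : ℝ) * Real.log n ≤ m * (3 * c) := by
        rw [hlog]
        gcongr
        linarith
      refine le_of_mul_le_mul_right ?_ hc0
      nlinarith
    have hnm : (n : ℝ) ≤ (m : ℝ) ^ 8 := by
      calc (n : ℝ) = c ^ 3 := hc3.symm
        _ ≤ (2 * (m : ℝ)) ^ 3 := by
          gcongr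
          linarith
        _ = 2 ^ 3 * (m : ℝ) ^ 3 := by ring
        _ ≤ (m : ℝ) ^ 5 * (m : ℝ) ^ 3 := by
          gcongr
          calc (2 : ℝ) ^ 3 ≤ 2 ^ 5 := by norm_num
            _ ≤ (m : ℝ) ^ 5 := by gcongr
        _ = (m : ℝ) ^ 8 := by ring
    -- The factor `8` is absorbed by the cube of the `2` in the lower end of the range.
    have hlnm : Real.log n ≤ 8 * Real.log m := by
      have := Real.log_le_log hn0 hnm
      rw [Real.log_pow] at this
      exact_mod_cast this
    have h5 : (2 * c ^ 2) ^ 3 ≤ (m * Real.log n) ^ 3 := pow_le_pow_left₀ (by positivity) h1 3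
    have h6 : 8 * (n : ℝ) ^ 2 ≤ (m : ℝ) ^ 3 * Real.log n ^ 2 * Real.log n := by
      rw [← hc3]
      rw [← hc3] at h5
      nlinarith
    have h7 : (m : ℝ) ^ 3 * Real.log n ^ 2 * Real.log n
        ≤ (m : ℝ) ^ 3 * Real.log n ^ 2 * (8 * Real.log m) := by gcongr
    linarith
  · rw [div_pow, div_le_div_iff₀ (by positivity) (by positivity)]
    -- The upper end of the range is needed only for `n ≤ m`; for `m ≤ n` the bound on `(log n)²`
    -- suffices.
    rcases le_total n m with hnm | hnm
    · have h3 : Real.log n ≤ Real.log m := Real.log_le_log hn0 (by exact_mod_cast hnm)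
      nlinarith
    · have h3 : (m : ℝ) ≤ n := by exact_mod_cast hnm
      have h4 := log_sq_le_mul_log_two hn1.le
      have h5 : Real.log 2 ≤ Real.log m := Real.log_le_log two_pos hm0
      calc Real.log n ^ 2 * m ≤ (n * Real.log m) * n := by
            gcongr
            exact h4.trans (by gcongr)
        _ = Real.log m * (n : ℝ) ^ 2 := by ring

/-! ### Borel–Cantelli over brackets and the rate. -/

/-- For brackets of polynomially many sets, almost surely eventually all increments of the
empirical process over pairs of brackets of mass at most `κ α_m` are of order `β_{n,m}`. -/
theorem IsIIDSample.eventually_bracket_increment_le {d : ℕ} {Ω : Type u} [MeasurableSpace Ω]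
    {P : Measure Ω} [IsProbabilityMeasure P] {μ : Measure (Fin d → ℝ)} [IsProbabilityMeasure μ]
    {X : ℕ → Ω → Fin d → ℝ} (hX : IsIIDSample P μ X)
    {A B : (m : ℕ) → (Fin d → Fin m) → Set (Fin d → ℝ)} (hA : ∀ m j, MeasurableSet (A m j))
    (hB : ∀ m j, MeasurableSet (B m j)) (κ : ℝ) :
    ∀ᵐ ω ∂P, ∀ᶠ n : ℕ in atTop, ∀ m : ℕ, 2 ≤ m → betaRate n m ≤ alphaRate m →
      ∀ j j', μ.real (symmDiff (A m j) (B m j')) ≤ κ * alphaRate m →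
        (empiricalFreq X n ω (B m j') - empiricalFreq X n ω (A m j))
          - (μ.real (B m j') - μ.real (A m j)) ≤ (κ + (12 * d + 8 : ℕ)) * betaRate n m := by
  -- The exponent pays `12 d` for at most `(n⁶)^(2d)` pairs and `6` for the orders `m`, leaving a
  -- summable `n⁻²`.
  set r : ℕ := 12 * d + 8 with hr
  set V : ℕ → ℕ → Set Ω := fun n m => ⋃ p : (Fin d → Fin m) × (Fin d → Fin m),
    {ω | μ.real (symmDiff (A m p.1) (B m p.2)) ≤ κ * alphaRate m ∧ (κ + r) * betaRate n m ≤
      (empiricalFreq X n ω (B m p.2) - empiricalFreq X n ω (A m p.1))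
        - (μ.real (B m p.2) - μ.real (A m p.1))} with hV
  set M : ℕ → Finset ℕ := fun n => (Finset.range (n ^ 6 + 1)).filter fun m =>
    2 ≤ m ∧ 3 ≤ n ∧ betaRate n m ≤ alphaRate m with hM
  have hVn : ∀ n m, m ∈ M n → P.real (V n m) ≤ (n : ℝ) ^ (12 * d) * ((n : ℝ) ^ r)⁻¹ := by
    intro n m hmM
    simp only [hM, Finset.mem_filter, Finset.mem_range] at hmM
    obtain ⟨hmn, hm2, hn3, hβα⟩ := hmM
    have hn0 : (0 : ℝ) < n := by positivity
    have ha := alphaRate_pos hm2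
    have ht0 : 0 ≤ betaRate n m / alphaRate m := div_nonneg (betaRate_nonneg n m) ha.le
    have ht1 : betaRate n m / alphaRate m ≤ 1 := (div_le_one ha).2 hβα
    -- With `t = β / α_m ≤ 1` the `κ` terms cancel, and `n β² / α_m = n α_n² = log n`.
    have hexp : (n : ℝ) * ((betaRate n m / alphaRate m) ^ 2 * (κ * alphaRate m)
        - betaRate n m / alphaRate m * ((κ + r) * betaRate n m)) = -(r * Real.log n) := by
      have h1 : (betaRate n m / alphaRate m) ^ 2 * (κ * alphaRate m)
          - betaRate n m / alphaRate m * ((κ + r) * betaRate n m)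
          = -(r * (betaRate n m ^ 2 / alphaRate m)) := by
        field_simp
        ring
      rw [h1, betaRate_sq, mul_div_cancel_right₀ _ ha.ne', alphaRate_sq]
      field_simp
    have hone : ∀ p : (Fin d → Fin m) × (Fin d → Fin m),
        P.real {ω | μ.real (symmDiff (A m p.1) (B m p.2)) ≤ κ * alphaRate m ∧
          (κ + r) * betaRate n m ≤
          (empiricalFreq X n ω (B m p.2) - empiricalFreq X n ω (A m p.1))
            - (μ.real (B m p.2) - μ.real (A m p.1))} ≤ ((n : ℝ) ^ r)⁻¹ := by
      intro p
      by_cases hp : μ.real (symmDiff (A m p.1) (B m p.2)) ≤ κ * alphaRate m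
      · have h := hX.measureReal_le_empiricalFreq_sub (hA m p.1) (hB m p.2) hp ht0 ht1
          ((κ + r) * betaRate n m) (n := n) (by omega)
        rw [hexp, Real.exp_neg, Real.exp_nat_mul, Real.exp_log hn0] at h
        simpa only [hp, true_and] using h
      · simp only [hp, false_and, Set.ofPred_false, measureReal_empty]
        positivity
    calc P.real (V n m) ≤ ∑ p : (Fin d → Fin m) × (Fin d → Fin m), ((n : ℝ) ^ r)⁻¹ :=
          (measureReal_iUnion_fintype_le _).trans (Finset.sum_le_sum fun p _ => hone p)
      _ = ((m : ℝ) ^ d * (m : ℝ) ^ d) * ((n : ℝ) ^ r)⁻¹ := by simp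
      _ ≤ (((n : ℝ) ^ 6) ^ d * ((n : ℝ) ^ 6) ^ d) * ((n : ℝ) ^ r)⁻¹ := by
          have : (m : ℝ) ≤ (n : ℝ) ^ 6 := by exact_mod_cast Nat.lt_succ_iff.1 hmn
          gcongr
      _ = (n : ℝ) ^ (12 * d) * ((n : ℝ) ^ r)⁻¹ := by
          rw [← pow_mul, ← pow_add]
          ring_nf
  have hEn : ∀ n, P.real (⋃ m ∈ M n, V n m) ≤ 2 * (1 / (n : ℝ) ^ 2) := by
    intro n
    rcases Nat.lt_or_ge n 3 with hn | hn
    · have : M n = ∅ := Finset.filter_eq_empty_iff.2 fun m _ h => by omega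
      rw [this]
      simp only [Finset.notMem_empty, Set.iUnion_of_empty, Set.iUnion_empty, measureReal_empty]
      positivity
    · have hn1 : (1 : ℝ) ≤ n := by exact_mod_cast (by omega : 1 ≤ n)
      have hcard : ((M n).card : ℝ) ≤ 2 * (n : ℝ) ^ 6 := by
        have h1 : (M n).card ≤ n ^ 6 + 1 :=
          (Finset.card_filter_le _ _).trans (Finset.card_range _).le
        have h2 : ((M n).card : ℝ) ≤ (n : ℝ) ^ 6 + 1 := by exact_mod_cast h1
        linarith [one_le_pow₀ hn1 (n := 6)]
      calc P.real (⋃ m ∈ M n, V n m) ≤ ∑ m ∈ M n, P.real (V n m) :=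
            measureReal_biUnion_finset_le _ _
        _ ≤ ∑ _m ∈ M n, (n : ℝ) ^ (12 * d) * ((n : ℝ) ^ r)⁻¹ :=
            Finset.sum_le_sum fun m hm => hVn n m hm
        _ = (M n).card * ((n : ℝ) ^ (12 * d) * ((n : ℝ) ^ r)⁻¹) := by
            rw [Finset.sum_const, nsmul_eq_mul]
        _ ≤ 2 * (n : ℝ) ^ 6 * ((n : ℝ) ^ (12 * d) * ((n : ℝ) ^ r)⁻¹) := by gcongr
        _ = 2 * (1 / (n : ℝ) ^ 2) := by
            have hn0 : (n : ℝ) ≠ 0 := by positivity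
            rw [hr, pow_add]
            field_simp
  have hsum : ∑' n, P (⋃ m ∈ M n, V n m) ≠ ⊤ := by
    have hS : Summable fun n : ℕ => 2 * (1 / (n : ℝ) ^ 2) :=
      (Real.summable_one_div_nat_pow.2 one_lt_two).mul_left 2
    refine ne_top_of_le_ne_top hS.tsum_ofReal_ne_top (ENNReal.tsum_le_tsum fun n => ?_)
    rw [← ofReal_measureReal (measure_ne_top _ _)]
    exact ENNReal.ofReal_le_ofReal (hEn n)
  filter_upwards [ae_eventually_notMem hsum] with ω hω
  filter_upwards [hω, eventually_ge_atTop 3] with n hn hn3 m hm2 hβα j j' hjj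
  by_contra hcon
  refine hn (Set.mem_iUnion₂.2 ⟨m, ?_, Set.mem_iUnion.2 ⟨(j, j'), hjj, (not_le.1 hcon).le⟩⟩)
  have hm6 := le_pow_six_of_betaRate_le_alphaRate hn3 hm2 hβα
  simp only [hM, Finset.mem_filter, Finset.mem_range]
  exact ⟨by omega, hm2, hn3, hβα⟩

/-- The Bernstein estimator is within `β_{n,m}` of the empirical c.d.f. -/
theorem exists_eventually_simplexSupNorm_bernsteinEstimator_sub_le {d : ℕ}
    (μ : Measure (Fin d → ℝ)) [IsProbabilityMeasure μ]
    (hF : DifferentiableOn ℝ (jointCDF μ) (unitSimplex d))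
    (hL : ∀ i : Fin d, ∃ L : NNReal, LipschitzOnWith L
      (fun x => fderivWithin ℝ (jointCDF μ) (unitSimplex d) x (Pi.single i 1)) (unitSimplex d)) :
    ∃ C : ℝ, 0 < C ∧ ∀ (Ω : Type u) [MeasurableSpace Ω] (P : Measure Ω) [IsProbabilityMeasure P]
      (X : ℕ → Ω → Fin d → ℝ), IsIIDSample P μ X →
      ∀ᵐ ω ∂P, ∀ᶠ n : ℕ in atTop, ∀ m : ℕ, 2 ≤ m →
        (m : ℝ)⁻¹ ≤ betaRate n m → betaRate n m ≤ alphaRate m →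
        simplexSupNorm (fun x => bernsteinEstimator X n m ω x - empiricalCDF X n ω x)
          ≤ C * betaRate n m := by
  obtain ⟨K, hK0, hK⟩ := exists_lipschitz_bound hF hL
  obtain ⟨K', hK'0, hK'⟩ := exists_abs_bernsteinPoly_sub_le hF hL
  have hbr : ∀ m : ℕ, ∃ A B : (Fin d → Fin m) → Set (Fin d → ℝ), (∀ j, MeasurableSet (A j)) ∧
      (∀ j, MeasurableSet (B j)) ∧ (1 ≤ m →
      ∀ x, ∃ j, A j ⊆ Set.Iic x ∧ Set.Iic x ⊆ B j ∧ μ.real (B j \ A j) ≤ d / m) := by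
    intro m
    by_cases hm : 1 ≤ m
    · obtain ⟨A, B, h1, h2, h3⟩ := exists_bracket_Iic μ hm
      exact ⟨A, B, h1, h2, fun _ => h3⟩
    -- A dummy choice for `m = 0`, where no bracketing is claimed.
    · exact ⟨fun _ => ∅, fun _ => ∅, fun _ => MeasurableSet.empty, fun _ => MeasurableSet.empty,
        fun h => absurd h hm⟩
  choose A B hA hB hAB using hbr
  -- Points within `2 α_m` have orthants differing by mass at most `4 K α_m`; the brackets add `2 d
  -- / m ≤ 2 d β ≤ 2 d α_m`.
  set κ : ℝ := 4 * K + 2 * d with hκ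
  set c : ℝ := κ + (12 * d + 8 : ℕ) with hc
  have hc0 : 0 ≤ c := by positivity
  -- In order: bracket deviations, bracket gaps, Chernoff tail, bias, and `1` for positivity.
  refine ⟨c + 2 * d + 4 * d + K' + 1, by positivity, fun Ω _ P _ X hX => ?_⟩
  filter_upwards [hX.eventually_bracket_increment_le hA hB κ] with ω hω
  filter_upwards [hω] with n hn m hm2 hmβ hβα
  have hm1 : 1 ≤ m := by omega
  have hβ0 := betaRate_nonneg n m
  refine simplexSupNorm_le (by positivity) fun x hx => ?_
  have hdm : 2 * (d : ℝ) / m ≤ 2 * d * betaRate n m := by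
    rw [div_eq_mul_inv]
    gcongr
  have hmod : ∀ y ∈ unitSimplex d, ‖y - x‖ ≤ 2 * alphaRate m →
      |(empiricalCDF X n ω y - jointCDF μ y) - (empiricalCDF X n ω x - jointCDF μ x)|
        ≤ c * betaRate n m + 2 * d / m := by
    intro y hy hxy
    refine abs_increment_le_of_brackets (hA m) (hAB m hm1) (δ := 4 * K * alphaRate m)
      (fun j j' hjj => hn m hm2 hβα j j' (hjj.trans ?_)) ?_
    · have := hdm.trans (mul_le_mul_of_nonneg_left hβα (by positivity))
      rw [hκ, add_mul]
      linarith
    · refine (measureReal_symmDiff_Iic_le hK0 hK hx hy).trans ?_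
      have := mul_le_mul_of_nonneg_left hxy (by positivity : 0 ≤ 2 * K)
      linarith
  have h1 := abs_bernsteinPoly_sub_le_of_modulus hm1
    (fun y => abs_empiricalCDF_sub_jointCDF_le X n ω μ y) (alphaRate_nonneg m) (alphaRate_le_one m)
    (by positivity : 0 ≤ c * betaRate n m + 2 * d / m) hx hmod
  rw [exp_neg_mul_alphaRate_sq hm1] at h1
  have h2 := hK' m hm1 x hx
  have h3 : 4 * (d : ℝ) * (m : ℝ)⁻¹ ≤ 4 * d * betaRate n m := by gcongr
  have h4 : K' * (m : ℝ)⁻¹ ≤ K' * betaRate n m := by gcongr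
  have hsplit : bernsteinEstimator X n m ω x - empiricalCDF X n ω x
      = (bernsteinPoly m (fun y => empiricalCDF X n ω y - jointCDF μ y) x
          - (empiricalCDF X n ω x - jointCDF μ x))
        + (bernsteinPoly m (jointCDF μ) x - jointCDF μ x) := by
    rw [bernsteinEstimator_eq X n m ω (jointCDF μ)]
    ring
  rw [hsplit]
  refine (abs_add_le _ _).trans ?_
  linarith

theorem mainTheorem6 (d : ℕ) (μ : Measure (Fin d → ℝ)) [IsProbabilityMeasure μ]
    (hF : ContinuousOn (jointCDF μ) (unitSimplex d)) :
    (∀ (Ω : Type u) [MeasurableSpace Ω] (P : Measure Ω) [IsProbabilityMeasure P]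
        (X : ℕ → Ω → Fin d → ℝ), IsIIDSample P μ X →
        ∀ᵐ ω ∂P, Tendsto
          (fun p : ℕ × ℕ =>
            simplexSupNorm fun x => bernsteinEstimator X p.1 p.2 ω x - jointCDF μ x)
          (atTop ×ˢ atTop) (𝓝 0)) ∧
    (DifferentiableOn ℝ (jointCDF μ) (unitSimplex d) →
      (∀ i : Fin d, ∃ L : NNReal, LipschitzOnWith L
        (fun x => fderivWithin ℝ (jointCDF μ) (unitSimplex d) x (Pi.single i 1))
        (unitSimplex d)) →
      ∃ C : ℝ, 0 < C ∧
        ∀ (Ω : Type u) [MeasurableSpace Ω] (P : Measure Ω) [IsProbabilityMeasure P]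
          (X : ℕ → Ω → Fin d → ℝ), IsIIDSample P μ X →
          (∀ᵐ ω ∂P, ∀ᶠ n : ℕ in atTop, ∀ m : ℕ, 2 ≤ m →
            (m : ℝ)⁻¹ ≤ betaRate n m → betaRate n m ≤ alphaRate m →
            simplexSupNorm (fun x => bernsteinEstimator X n m ω x - empiricalCDF X n ω x)
              ≤ C * betaRate n m) ∧
          (∀ᵐ ω ∂P, ∀ᶠ n : ℕ in atTop,
            simplexSupNorm (fun x => bernsteinEstimator X n n ω x - empiricalCDF X n ω x)
              ≤ C * ((n : ℝ) ^ (-(3 / 4) : ℝ) * Real.log n ^ (3 / 4 : ℝ)))) ∧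
    (∀ n m : ℕ, 2 ≤ n → 2 * (n : ℝ) ^ (2 / 3 : ℝ) / Real.log n ≤ (m : ℝ) →
      (m : ℝ) ≤ (n : ℝ) ^ 2 / Real.log n →
      2 ≤ m ∧ (m : ℝ)⁻¹ ≤ betaRate n m ∧ betaRate n m ≤ alphaRate m) := by
  refine ⟨fun Ω _ P _ X hX => hX.tendsto_simplexSupNorm_bernsteinEstimator_sub hF,
    fun hD hL => ?_, fun n m hn h1 h2 => rate_conditions_of_range hn h1 h2⟩
  obtain ⟨C, hC, h⟩ := exists_eventually_simplexSupNorm_bernsteinEstimator_sub_le.{u} μ hD hL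
  refine ⟨C, hC, fun Ω _ P _ X hX => ⟨h Ω P X hX, ?_⟩⟩
  filter_upwards [h Ω P X hX] with ω hω
  -- From `n = 3` on, `log n ≥ 1`, which gives `1 / n ≤ β_{n,n}`.
  filter_upwards [hω, eventually_ge_atTop 3] with n hn hn3
  rw [← betaRate_self (by omega)]
  exact hn n (by omega) (inv_le_betaRate_self hn3) betaRate_self_le_alphaRate
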